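/- **Setting.** Let $k\in[0,1)$, $k'=\sqrt{1-k^2}$, $K=\int_0^{\pi/2}\frac{d\tau}{\sqrt{1-k^2\sin^2\tau}}$, $E=\int_0^{\pi/2}\sqrt{1-k^2\sin^2\tau}\,d\tau$; let $\mathrm{sc}(\cdot|k)$, $\mathrm{dc}(\cdot|k)$ be the Jacobi elliptic functions, and $$A(u|k)=\frac1{k'}\Bigl(\int_0^u \mathrm{dc}^2(v|k)\,dv+\frac{E-K}{K}\,u\Bigr).$$ A finite planar graph, drawn in the plane with straight edges, is *isoradial* if every internal face is inscribed in a circle of radius $1$ whose centre is in the interior of the face, and if every edge $e$ is the diagonal of a non-flat rhombus of side length $1$ (for edges bordering an internal face this is automatic). Let $\bar\theta_e\in(0,\pi/2)$ be the half-angle of this rhombus at the ends of $e$, and $\theta_e=\frac{2K}{\pi}\bar\theta_e\in(0,K)$. Edges are given the conductances $\rho(e)=\mathrm{sc}(\theta_e|k)$ and vertices the squared masses $$m^2(x|k)=\sum_{e\ni x}\bigl[A(\theta_e|k)-\mathrm{sc}(\theta_e|k)\bigr].$$ Let $G_Y$ and $G_\Delta$ be finite isoradial graphs that differ by a *star-triangle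 move*: $G_Y$ has a vertex $x_0$ of degree $3$ with neighbours $x_1,x_2,x_3$, such that the rhombi of the three edges $x_0x_\ell$ fit together around $x_0$ into a hexagon (consecutive rhombi share a side), no two of $x_1,x_2,x_3$ are adjacent in $G_Y$, and $G_\Delta$ is obtained from $G_Y$ by removing $x_0$ and its three edges and joining $x_1,x_2,x_3$ pairwise, the other vertices and edges being left in place. Write $\theta_\ell=\theta_{x_0x_\ell}$. For a graph $G$, let $G^{r}$ be the graph obtained by adding a vertex $r$ joined to every vertex of $G$; an edge of $G$ keeps its conductance as weight and the edge $xr$ has weight $m^2(x)$. (Spanning trees of $G^r$ correspond, with their weights, to rooted spanning forests of $G$.) Let $G'$ be the graph obtained from $G_Y^{r}$ by removing $x_0$ with all its edges and the edges $x_1r,x_2r,x_3r$; it is also $G_\Delta^r$ without the edges $x_\ell r$ and $x_ix_j$. For a set $S$ of edges of $G'$ that can be extended, by edges not in $G'$, both to a spanning tree of $G_Y^r$ and to a spanning tree of $G_\Delta^r$, let $Z(G_Y|S)$ (resp. $Z(G_\Delta|S)$) be the sum, over all spanning trees $T$ of $G_Y^r$ (resp. $G_\Delta^r$) whose set of edges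 in $G'$ is $S$, of the product of the weights of the edges of $T\setminus S$. **Theorem.** For every $k\in[0,1)$, the rooted spanning forest model with these conductances and masses is $Z$-invariant: for all $G_Y,G_\Delta$ as above and every such $S$, $$Z(G_Y|S)=C(k)\,Z(G_\Delta|S),\qquad C(k)=k'\,\mathrm{sc}(\theta_1|k)\,\mathrm{sc}(\theta_2|k)\,\mathrm{sc}(\theta_3|k).$$ -/

import Mathlib

open scoped Real

noncomputable section

/-! ## Jacobi elliptic functions on the real line, for a modulus `k ∈ [0,1)` -/

/-- The complementary elliptic modulus `k' = √(1 - k²)`. -/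
def complModulus (k : ℝ) : ℝ := √(1 - k ^ 2)

/-- The incomplete elliptic integral of the first kind `F(φ|k) = ∫₀^φ dτ / √(1 - k² sin² τ)`. -/
def ellipticF (k φ : ℝ) : ℝ := ∫ τ in (0 : ℝ)..φ, 1 / √(1 - k ^ 2 * Real.sin τ ^ 2)

/-- The complete elliptic integral of the first kind `K(k)`. -/
def ellipticK (k : ℝ) : ℝ := ∫ τ in (0 : ℝ)..(π / 2), 1 / √(1 - k ^ 2 * Real.sin τ ^ 2)

/-- The complete elliptic integral of the second kind `E(k)`. -/
def ellipticE (k : ℝ) : ℝ := ∫ τ in (0 : ℝ)..(π / 2), √(1 - k ^ 2 * Real.sin τ ^ 2)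

/-- For `k ∈ [0,1)`, `φ ↦ F(φ|k)` is a bijection of the real line, so that it has an inverse. -/
theorem ellipticF_bijective {k : ℝ} (hk : k ∈ Set.Ico (0 : ℝ) 1) :
    Function.Bijective (ellipticF k) := by
  have hpos : ∀ τ : ℝ, 0 < 1 - k ^ 2 * Real.sin τ ^ 2 := by
    intro τ
    have h1 : Real.sin τ ^ 2 ≤ 1 := Real.sin_sq_le_one τ
    have h2 : k ^ 2 < 1 := by nlinarith [hk.1, hk.2]
    nlinarith [sq_nonneg k, sq_nonneg (Real.sin τ)]
  have hc : Continuous fun τ : ℝ => 1 / √(1 - k ^ 2 * Real.sin τ ^ 2) := by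
    refine continuous_const.div (by fun_prop) fun τ => ?_
    exact (Real.sqrt_pos.2 (hpos τ)).ne'
  have hd : ∀ φ, HasDerivAt (ellipticF k) (1 / √(1 - k ^ 2 * Real.sin φ ^ 2)) φ := fun φ =>
    intervalIntegral.integral_hasDerivAt_right (hc.intervalIntegrable _ _)
      hc.stronglyMeasurable.stronglyMeasurableAtFilter hc.continuousAt
  have hge : ∀ τ : ℝ, 1 ≤ 1 / √(1 - k ^ 2 * Real.sin τ ^ 2) := by
    intro τ
    rw [le_div_iff₀ (Real.sqrt_pos.2 (hpos τ)), one_mul]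
    exact Real.sqrt_le_one.2 (by nlinarith [mul_nonneg (sq_nonneg k) (sq_nonneg (Real.sin τ))])
  have hmono : Monotone fun φ => ellipticF k φ - φ := by
    refine monotone_of_hasDerivAt_nonneg (fun φ => (hd φ).sub (hasDerivAt_id φ)) fun φ => ?_
    simpa using hge φ
  have h0 : ellipticF k 0 = 0 := by simp [ellipticF]
  constructor
  · intro a b hab
    rcases lt_trichotomy a b with h | h | h
    · have := hmono h.le
      simp only at this
      linarith
    · exact h
    · have := hmono h.le
      simp only at this
      linarith
  · have hcont : Continuous (ellipticF k) :=
      continuous_iff_continuousAt.2 fun φ => (hd φ).continuousAt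
    refine hcont.surjective ?_ ?_
    · refine Filter.tendsto_atTop_mono' _ ?_ Filter.tendsto_id
      filter_upwards [Filter.eventually_ge_atTop 0] with φ hφ
      have := hmono hφ
      simp only [h0] at this
      simp only [id]
      linarith
    · refine Filter.tendsto_atBot_mono' _ ?_ Filter.tendsto_id
      filter_upwards [Filter.eventually_le_atBot 0] with φ hφ
      have := hmono hφ
      simp only [h0] at this
      simp only [id]
      linarith

/-- The Jacobi amplitude `am(u|k)`: the inverse function of `φ ↦ F(φ|k)`. -/
def jacobiAm (k u : ℝ) : ℝ := Function.invFun (ellipticF k) u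

/-- `sn = sin am`. -/
def jacobiSn (k u : ℝ) : ℝ := Real.sin (jacobiAm k u)

/-- `cn = cos am`. -/
def jacobiCn (k u : ℝ) : ℝ := Real.cos (jacobiAm k u)

/-- `dn = √(1 - k² sn²)`. -/
def jacobiDn (k u : ℝ) : ℝ := √(1 - k ^ 2 * jacobiSn k u ^ 2)

/-- `sc = sn / cn`. -/
def jacobiSc (k u : ℝ) : ℝ := jacobiSn k u / jacobiCn k u

/-- `dc = dn / cn`. -/
def jacobiDc (k u : ℝ) : ℝ := jacobiDn k u / jacobiCn k u

/-- `A(u|k) = (1/k') (∫₀^u dc²(v|k) dv + ((E - K)/K) u)`. It is used only for `0 < u < K`, where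
the integrand is continuous on `[0,u]`. -/
def ellipticA (k u : ℝ) : ℝ :=
  1 / complModulus k *
    ((∫ v in (0 : ℝ)..u, jacobiDc k v ^ 2) + (ellipticE k - ellipticK k) / ellipticK k * u)

/-! ## Isoradial graphs -/

/-- The subset of the plane covered by a graph with vertices placed by `pos` and with straight
edges. -/
def planeDrawing {V : Type*} (G : SimpleGraph V) (pos : V → ℂ) : Set ℂ :=
  Set.range pos ∪ {z | ∃ u v, G.Adj u v ∧ z ∈ segment ℝ (pos u) (pos v)}

/-- The internal faces of a drawing: the bounded connected components of its complement. -/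
def IsInternalFace {V : Type*} (G : SimpleGraph V) (pos : V → ℂ) (F : Set ℂ) : Prop :=
  (∃ z ∈ (planeDrawing G pos)ᶜ, F = connectedComponentIn (planeDrawing G pos)ᶜ z) ∧
    Bornology.IsBounded F

/-- An isoradial graph together with an isoradial embedding, the common radius being `1`
(to be used with a finite vertex set). -/
structure IsoradialGraph (V : Type*) where
  /-- the underlying graph -/
  graph : SimpleGraph V
  /-- the position of the vertices in the plane -/
  pos : V → ℂ
  pos_injective : Function.Injective pos
  /-- no vertex lies on an edge of which it is not an end -/
  vertex_edge : ∀ u v w, graph.Adj u v → pos w ∈ segment ℝ (pos u) (pos v) → w = u ∨ w = v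
  /-- two different edges can meet only at a common end -/
  edge_edge : ∀ u v u' v', graph.Adj u v → graph.Adj u' v' → s(u, v) ≠ s(u', v') →
    ∀ z ∈ segment ℝ (pos u) (pos v) ∩ segment ℝ (pos u') (pos v'),
      ∃ w, w ∈ s(u, v) ∧ w ∈ s(u', v') ∧ z = pos w
  /-- every internal face is inscribed in a circle of radius `1` whose centre is in the interior
  of the face -/
  inscribed : ∀ F, IsInternalFace graph pos F →
    ∃ c ∈ F, ∀ v, pos v ∈ frontier F → dist c (pos v) = 1
  /-- every edge is the diagonal of a non-flat rhombus of side length `1`; this is automatic for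
  the edges that border an internal face -/
  edge_lt : ∀ u v, graph.Adj u v → dist (pos u) (pos v) < 2

namespace IsoradialGraph

variable {V : Type*} (G : IsoradialGraph V)

/-- The half-angle, at a vertex of the edge `uv`, of the rhombus of side length `1` having `uv`
as a diagonal. As the diagonals of a rhombus are orthogonal, its cosine is `|uv| / 2`. -/
def halfAngle (u v : V) : ℝ := Real.arccos (dist (G.pos u) (G.pos v) / 2)

/-- The elliptic angle `θ_e = (2K/π) · (rhombus half-angle)` of the edge `uv`. -/
def angle (k : ℝ) (u v : V) : ℝ := G.halfAngle u v * (2 * ellipticK k / π)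

theorem angle_comm (k : ℝ) (u v : V) : G.angle k u v = G.angle k v u := by
  simp only [angle, halfAngle, dist_comm]

/-- The conductance `sc(θ_e|k)`. -/
def conductance (k : ℝ) : Sym2 V → ℝ :=
  Sym2.lift ⟨fun u v => jacobiSc k (G.angle k u v), fun u v =>
    congrArg (jacobiSc k) (G.angle_comm k u v)⟩

open Classical in
/-- The squared mass `m²(x|k) = ∑ (A(θ_j|k) - sc(θ_j|k))`, a sum over the edges at `x`. -/
def massSq [Fintype V] (k : ℝ) (x : V) : ℝ :=
  ∑ y ∈ Finset.univ.filter fun y => G.graph.Adj x y,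
    (ellipticA k (G.angle k x y) - jacobiSc k (G.angle k x y))

end IsoradialGraph

/-! ## The star-triangle transformation -/

/-- `Gs` and `Gt` differ by a star-triangle transformation. The vertices of `Gs` are those of `Gt`
and one more, `none`, the centre of the star; `x 0`, `x 1`, `x 2` are its three neighbours, in
counterclockwise order. -/
structure IsStarTriangle {V : Type*} (Gs : IsoradialGraph (Option V)) (Gt : IsoradialGraph V)
    (x : Fin 3 → V) : Prop where
  injective : Function.Injective x
  /-- the common vertices do not move -/
  pos_eq : ∀ v, Gs.pos (some v) = Gt.pos v
  /-- the centre has degree three, its neighbours being the `x i` -/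
  star_adj : ∀ v, Gs.graph.Adj none (some v) ↔ ∃ i, v = x i
  /-- the `x i` form a triangle of `Gt` -/
  triangle_adj : ∀ i j, i ≠ j → Gt.graph.Adj (x i) (x j)
  /-- apart from the star and from the triangle, the two graphs have the same edges -/
  other_adj : ∀ u v, Gs.graph.Adj (some u) (some v) ↔
    Gt.graph.Adj u v ∧ ¬ ((∃ i, u = x i) ∧ ∃ j, v = x j)
  /-- The rhombi of the three edges of the star fit together around its centre and make up a
  hexagon: the rhombus vectors of these edges, read from the centre, are
  `(e^{iα}, e^{iβ})`, `(e^{iβ}, e^{iγ})` and `(e^{iγ}, e^{iα})`. -/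
  rhombi : ∃ α β γ : ℝ,
    (α < β ∧ β < α + π) ∧ (β < γ ∧ γ < β + π) ∧ (γ < α + 2 * π ∧ α + 2 * π < γ + π) ∧
    Gs.pos (some (x 0)) =
      Gs.pos none + Complex.exp (α * Complex.I) + Complex.exp (β * Complex.I) ∧
    Gs.pos (some (x 1)) =
      Gs.pos none + Complex.exp (β * Complex.I) + Complex.exp (γ * Complex.I) ∧
    Gs.pos (some (x 2)) =
      Gs.pos none + Complex.exp (γ * Complex.I) + Complex.exp (α * Complex.I)

/-! ## Spanning trees of the graph with an added root, and Z-invariance -/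

/-- The vertices of a graph together with one added vertex, the root. -/
abbrev Rooted (V : Type*) : Type _ := V ⊕ Unit

/-- The added root. -/
def root (V : Type*) : Rooted V := Sum.inr ()

/-- The graph obtained from `G` by adding a root and joining every vertex of `G` to it. -/
def rootedGraph {V : Type*} (G : SimpleGraph V) : SimpleGraph (Rooted V) where
  Adj a b := match a, b with
    | Sum.inl u, Sum.inl v => G.Adj u v
    | Sum.inl _, Sum.inr _ => True
    | Sum.inr _, Sum.inl _ => True
    | Sum.inr _, Sum.inr _ => False
  symm := ⟨by
    rintro (u | u) (v | v) h
    · exact G.adj_symm h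
    · trivial
    · trivial
    · exact h⟩
  loopless := ⟨by
    rintro (u | u) h
    · exact G.irrefl h
    · exact h⟩

/-- The weights of the edges of the rooted graph: the conductance for an edge of the graph, the
squared mass of `x` for the edge joining `x` to the root. -/
def rootedWeight {V : Type*} (ρ : Sym2 V → ℝ) (m2 : V → ℝ) : Sym2 (Rooted V) → ℝ :=
  Sym2.lift ⟨fun a b => match a, b with
    | Sum.inl u, Sum.inl v => ρ s(u, v)
    | Sum.inl u, Sum.inr _ => m2 u
    | Sum.inr _, Sum.inl v => m2 v
    | Sum.inr _, Sum.inr _ => 0, by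
    rintro (u | u) (v | v)
    · exact congrArg ρ Sym2.eq_swap
    · rfl
    · rfl
    · rfl⟩

/-- `T` is the edge set of a spanning tree of `H`. -/
def IsSpanningTree {U : Type*} (H : SimpleGraph U) (T : Finset (Sym2 U)) : Prop :=
  (T : Set (Sym2 U)) ⊆ H.edgeSet ∧ (SimpleGraph.fromEdgeSet (T : Set (Sym2 U))).IsTree

/-- `T` is a spanning tree of `H` which coincides with `S` on the edges belonging to `D`. -/
def IsTreeExtension {U : Type*} (H : SimpleGraph U) (D : Set (Sym2 U)) (S T : Finset (Sym2 U)) :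
    Prop :=
  IsSpanningTree H T ∧ (T : Set (Sym2 U)) ∩ D = S

open Classical in
/-- The restricted partition function: the sum, over the spanning trees `T` of `H` which coincide
with `S` on `D`, of the weight of the edges of `T` outside `D`. -/
def restrictedZ {U : Type*} [Fintype U] (H : SimpleGraph U) (w : Sym2 U → ℝ) (D : Set (Sym2 U))
    (S : Finset (Sym2 U)) : ℝ :=
  ∑ T ∈ Finset.univ.filter fun T => IsTreeExtension H D S T,
    ∏ e ∈ T.filter fun e => e ∉ D, w e

/-- The inclusion of the common vertices (and of the root) in the rooted star graph. -/
def commonVertex {V : Type*} : Rooted V → Rooted (Option V) := Sum.map some id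

/-- The graph `G'`: the rooted star graph from which the centre of the star and its edges, and the
edges joining the `x i` to the root, have been removed. -/
def outerGraph {V : Type*} (Gs : SimpleGraph (Option V)) (x : Fin 3 → V) :
    SimpleGraph (Rooted V) :=
  ((rootedGraph Gs).comap commonVertex).deleteEdges {e | ∃ i, e = s(Sum.inl (x i), root V)}

/-- `G'` is also the rooted triangle graph from which the edges of the triangle and the edges
joining the `x i` to the root have been removed. -/
theorem outerGraph_eq {V : Type*} {Gs : IsoradialGraph (Option V)} {Gt : IsoradialGraph V}
    {x : Fin 3 → V} (h : IsStarTriangle Gs Gt x) :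
    outerGraph Gs.graph x = (rootedGraph Gt.graph).deleteEdges
      ({e | ∃ i, e = s(Sum.inl (x i), root V)} ∪
        {e | ∃ i j, e = s(Sum.inl (x i), Sum.inl (x j))}) := by
  ext a b
  rcases a with u | u <;> rcases b with v | v
  · simp [outerGraph, rootedGraph, commonVertex, root, h.other_adj]
    grind
  · simp [outerGraph, rootedGraph, commonVertex, root]
  · simp [outerGraph, rootedGraph, commonVertex, root]
  · simp [outerGraph, rootedGraph, commonVertex]

open Classical in
/-- The rooted spanning forest model, with conductances `ρs`, `ρt` and squared masses `ms`, `mt`, is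
Z-invariant with constant `C` for the star-triangle move between `Gs` and `Gt`: for every edge
configuration `S` of `G'` which can be extended to a spanning tree of both rooted graphs, the
restricted partition functions satisfy `Z(Gs|S) = C Z(Gt|S)`. -/
def IsZInvariantWith {V : Type*} [Fintype V] (Gs : SimpleGraph (Option V)) (Gt : SimpleGraph V)
    (x : Fin 3 → V) (ρs : Sym2 (Option V) → ℝ) (ms : Option V → ℝ) (ρt : Sym2 V → ℝ) (mt : V → ℝ)
    (C : ℝ) : Prop :=
  ∀ S : Finset (Sym2 (Rooted V)), (S : Set (Sym2 (Rooted V))) ⊆ (outerGraph Gs x).edgeSet →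
    (∃ T, IsTreeExtension (rootedGraph Gs) (Sym2.map commonVertex '' (outerGraph Gs x).edgeSet)
      (S.image (Sym2.map commonVertex)) T) →
    (∃ T, IsTreeExtension (rootedGraph Gt) (outerGraph Gs x).edgeSet S T) →
    restrictedZ (rootedGraph Gs) (rootedWeight ρs ms)
        (Sym2.map commonVertex '' (outerGraph Gs x).edgeSet) (S.image (Sym2.map commonVertex)) =
      C * restrictedZ (rootedGraph Gt) (rootedWeight ρt mt) (outerGraph Gs x).edgeSet S

end

/-! Once `S` is fixed, a restricted partition function sees the outer graph only through the
partition of `x 0`, `x 1`, `x 2` and the root induced by the components of the forest `S`. Deletion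
and contraction of the remaining edges (`treeSum_insert`) therefore turns each side into the tree
sum of a small network whose vertices carry component labels (`treeSum_eq_networkSum`).

The two networks are related by electrical reduction. The centre is a star with four branches, of
weights `s i = sc θ_i` towards `x i` and `m²` towards the root. If `C` is the sum of the four
weights, eliminating the centre gives the factor `C` and, between two branch ends, an edge whose
weight is the product of the branch weights divided by `C` (`networkSum_star`). Hence Z-invariance
follows from three identities (`IsStarTriangle.isZInvariantWith`): the value of `C`, the triangle
conductances `s i * s j / C`, and the mass increments `s i * m² / C`.

These identities are elliptic. The hexagon gives `θ_0 + θ_1 + θ_2 = 2K`, and each triangle edge has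
angle `K - θ_l`, with `l` the opposite index. The conductances match because `sc (K - u) = 1 / (k'
sc u)`. As `m² + ∑ sc θ_i = ∑ A(θ_i)`, the constant and the masses both come from one addition
formula, `A(u+v) = A(u) + A(v) + k' sc u sc v sc(u+v)`: it is used with `u + v = 2K - w` for the
constant, and with the arguments `K - v`, `K - w` for the masses. It is obtained from the addition
formulas for `sn`, `cn`, `dn` and for Jacobi's epsilon function. -/

noncomputable section

/-! ## Spanning trees by deletion and contraction -/

open Classical in
/-- The sum, over the sets `Q ⊆ E` which complete `S` into a spanning tree, of the weight of `Q`. -/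
def treeSum {U : Type*} (w : Sym2 U → ℝ) (S E : Finset (Sym2 U)) : ℝ :=
  ∑ Q ∈ E.powerset,
    if (SimpleGraph.fromEdgeSet ((S ∪ Q : Finset (Sym2 U)) : Set (Sym2 U))).IsTree
    then ∏ e ∈ Q, w e else 0

/-- A tree extending `S` is determined by its edges outside `D`: the maps `T ↦ T \ D` and `Q ↦ S ∪
Q` are mutually inverse. -/
theorem restrictedZ_eq_treeSum {U : Type*} [Fintype U] {H : SimpleGraph U} (w : Sym2 U → ℝ)
    {D : Set (Sym2 U)} {S E : Finset (Sym2 U)} (hD : D ⊆ H.edgeSet) (hS : (S : Set (Sym2 U)) ⊆ D)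
    (hE : (E : Set (Sym2 U)) = H.edgeSet \ D) :
    restrictedZ H w D S = treeSum w S E := by
  classical
  have hE' : ∀ e, e ∈ E ↔ e ∈ H.edgeSet ∧ e ∉ D := fun e => by
    rw [← Finset.mem_coe, hE]; rfl
  rw [restrictedZ, treeSum, ← Finset.sum_filter]
  refine Finset.sum_bij' (fun T _ => T.filter fun e => e ∉ D) (fun Q _ => S ∪ Q) ?_ ?_ ?_ ?_ ?_
  · intro T hT
    obtain ⟨⟨hTH, hT⟩, hTD⟩ := (Finset.mem_filter.1 hT).2
    have hST : S ∪ T.filter (fun e => e ∉ D) = T := by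
      ext e
      have := Set.ext_iff.1 hTD e
      simp only [Set.mem_inter_iff, Finset.mem_coe] at this
      simp only [Finset.mem_union, Finset.mem_filter]
      tauto
    simp only [Finset.mem_filter, Finset.mem_powerset, hST]
    refine ⟨fun e he => ?_, hT⟩
    rw [Finset.mem_filter] at he
    exact (hE' e).2 ⟨hTH he.1, he.2⟩
  · intro Q hQ
    simp only [Finset.mem_filter, Finset.mem_powerset] at hQ
    simp only [Finset.mem_filter, Finset.mem_univ, true_and]
    refine ⟨⟨fun e he => ?_, hQ.2⟩, ?_⟩
    · rcases Finset.mem_union.1 (Finset.mem_coe.1 he) with h | h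
      · exact hD (hS h)
      · exact ((hE' e).1 (hQ.1 h)).1
    · ext e
      simp only [Finset.coe_union, Set.mem_inter_iff, Set.mem_union, Finset.mem_coe]
      have h1 : e ∈ S → e ∈ D := fun h => hS h
      have h2 : e ∈ Q → e ∉ D := fun h => ((hE' e).1 (hQ.1 h)).2
      tauto
  · intro T hT
    obtain ⟨-, hTD⟩ := (Finset.mem_filter.1 hT).2
    ext e
    have := Set.ext_iff.1 hTD e
    simp only [Set.mem_inter_iff, Finset.mem_coe] at this
    simp only [Finset.mem_union, Finset.mem_filter]
    tauto
  · intro Q hQ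
    simp only [Finset.mem_filter, Finset.mem_powerset] at hQ
    ext e
    have h1 : e ∈ S → e ∈ D := fun h => hS h
    have h2 : e ∈ Q → e ∉ D := fun h => ((hE' e).1 (hQ.1 h)).2
    simp only [Finset.mem_union, Finset.mem_filter]
    tauto
  · intro T _
    rfl

-- Deletion-contraction: either `e` is not used, or it is used and joins the prescribed edges.
open Classical in
theorem treeSum_insert {U : Type*} (w : Sym2 U → ℝ) (S : Finset (Sym2 U)) {E : Finset (Sym2 U)}
    {e : Sym2 U} (he : e ∉ E) :
    treeSum w S (insert e E) = treeSum w S E + w e * treeSum w (insert e S) E := by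
  rw [treeSum, Finset.sum_powerset_insert he, treeSum, treeSum, Finset.mul_sum]
  congr 1
  refine Finset.sum_congr rfl fun Q hQ => ?_
  have heQ : e ∉ Q := fun h => he (Finset.mem_powerset.1 hQ h)
  rw [Finset.prod_insert heQ, Finset.union_insert, Finset.insert_union, mul_ite, mul_zero]

theorem treeSum_eq_zero {U : Type*} (w : Sym2 U → ℝ) {S : Finset (Sym2 U)} (E : Finset (Sym2 U))
    (hS : ¬ (SimpleGraph.fromEdgeSet (S : Set (Sym2 U))).IsAcyclic) : treeSum w S E = 0 := by
  classical
  refine Finset.sum_eq_zero fun Q _ => if_neg fun h => hS ?_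
  exact h.isAcyclic.anti (SimpleGraph.fromEdgeSet_mono (by simp))

/-- `S` is the edge set of a forest, whose connected components are the fibres of `L`. -/
structure IsForestLabelling {U κ : Type*} (S : Finset (Sym2 U)) (L : U → κ) : Prop where
  acyclic : (SimpleGraph.fromEdgeSet (S : Set (Sym2 U))).IsAcyclic
  reachable_iff : ∀ u v, (SimpleGraph.fromEdgeSet (S : Set (Sym2 U))).Reachable u v ↔ L u = L v

/-- The labelling obtained from `L` by giving the label of `j` to all that has the label of `i`. -/
def mergeLabel {β κ : Type*} [DecidableEq κ] (L : β → κ) (i j : β) : β → κ :=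
  fun l => if L l = L i then L j else L l

theorem eq_of_reachable {U κ : Type*} {G : SimpleGraph U} {L : U → κ}
    (h : ∀ u v, G.Adj u v → L u = L v) {u v : U} (huv : G.Reachable u v) : L u = L v := by
  obtain ⟨p⟩ := huv
  induction p with
  | nil => rfl
  | cons hadj _ ih => exact (h _ _ hadj).trans ih

theorem fromEdgeSet_insert {U : Type*} (S : Set (Sym2 U)) (u v : U) :
    SimpleGraph.fromEdgeSet (insert s(u, v) S) =
      SimpleGraph.fromEdgeSet S ⊔ SimpleGraph.edge u v := by
  rw [Set.insert_eq, Set.union_comm, SimpleGraph.edge, SimpleGraph.fromEdgeSet_union]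

-- The new edge joins two different components, so it closes no cycle and has the sole effect of
-- fusing them.
open Classical in
theorem IsForestLabelling.insert {U κ : Type*} [DecidableEq κ] {S : Finset (Sym2 U)} {L : U → κ}
    (h : IsForestLabelling S L) {u v : U} (huv : L u ≠ L v) :
    IsForestLabelling (insert s(u, v) S) (mergeLabel L u v) := by
  have hle : SimpleGraph.fromEdgeSet (S : Set (Sym2 U)) ≤
      SimpleGraph.fromEdgeSet (S : Set (Sym2 U)) ⊔ SimpleGraph.edge u v := le_sup_left
  have hne : u ≠ v := fun h => huv (congrArg L h)
  refine ⟨?_, fun a b => ?_⟩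
  · rw [Finset.coe_insert, fromEdgeSet_insert]
    exact h.acyclic.sup_edge_of_not_reachable (by rwa [h.reachable_iff])
  · rw [Finset.coe_insert, fromEdgeSet_insert]
    have huv' : (SimpleGraph.fromEdgeSet (S : Set (Sym2 U)) ⊔ SimpleGraph.edge u v).Reachable u v :=
      SimpleGraph.Adj.reachable (Or.inr (by simp [SimpleGraph.edge_adj, hne]))
    constructor
    · refine eq_of_reachable fun a b hab => ?_
      rcases hab with hab | hab
      · have := (h.reachable_iff a b).1 hab.reachable
        simp only [mergeLabel, this]
      · rw [SimpleGraph.edge_adj] at hab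
        obtain ⟨⟨rfl, rfl⟩ | ⟨rfl, rfl⟩, -⟩ := hab <;> simp [mergeLabel]
    · intro hab
      -- The merged label of `a` is the old label of some vertex reachable from `a`: `v` if `a` lies
      -- in the component of `u`, and `a` itself otherwise.
      have key : ∀ a, ∃ a', mergeLabel L u v a = L a' ∧
          (SimpleGraph.fromEdgeSet (S : Set (Sym2 U)) ⊔ SimpleGraph.edge u v).Reachable a a' := by
        intro a
        by_cases ha : L a = L u
        · exact ⟨v, by simp [mergeLabel, ha],
            (((h.reachable_iff a u).2 ha).mono hle).trans huv'⟩
        · exact ⟨a, by simp [mergeLabel, ha], SimpleGraph.Reachable.rfl⟩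
      obtain ⟨a', ha, ha'⟩ := key a
      obtain ⟨b', hb, hb'⟩ := key b
      exact (ha'.trans (((h.reachable_iff a' b').2 (ha ▸ hb ▸ hab)).mono hle)).trans hb'.symm

/-- The weighted number of spanning trees of the multigraph whose edges are listed, the vertices
having the same label being identified. -/
def networkSum {β κ : Type*} [DecidableEq κ] [DecidableEq β] [Fintype β] :
    List (β × β × ℝ) → (β → κ) → ℝ
  | [], L => if ∀ i j, L i = L j then 1 else 0
  | e :: es, L => networkSum es L +
      if L e.1 = L e.2.1 then 0 else e.2.2 * networkSum es (mergeLabel L e.1 e.2.1)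

-- Contracting an edge adds it to `S` and merges two labels, so the two recursions agree. By `hb`
-- every component of the forest meets the range of `b`; connectedness can thus be tested on the
-- labels of `β` alone.
open Classical in
theorem treeSum_eq_networkSum {U β κ : Type*} [DecidableEq κ] [DecidableEq β] [Fintype β]
    [Nonempty β] (w : Sym2 U → ℝ) (b : β → U) (es : List (β × β × ℝ))
    (hes : ∀ e ∈ es, b e.1 ≠ b e.2.1 ∧ w s(b e.1, b e.2.1) = e.2.2)
    (hnd : (es.map fun e => s(b e.1, b e.2.1)).Nodup)
    (S : Finset (Sym2 U)) (L : U → κ) (hL : IsForestLabelling S L)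
    (hb : ∀ u, ∃ i, L u = L (b i)) (hS : ∀ e ∈ es, s(b e.1, b e.2.1) ∉ S) :
    treeSum w S (es.map fun e => s(b e.1, b e.2.1)).toFinset = networkSum es (L ∘ b) := by
  induction es generalizing S L with
  | nil =>
    simp only [treeSum, networkSum, List.map_nil, List.toFinset_nil, Finset.powerset_empty,
      Finset.sum_singleton, Finset.union_empty, Finset.prod_empty, Function.comp_apply]
    refine if_congr ?_ rfl rfl
    constructor
    · intro h i j
      exact (hL.reachable_iff _ _).1 (h.connected.preconnected _ _)
    · intro h
      have : Nonempty U := ⟨b (Classical.arbitrary β)⟩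
      refine ⟨⟨fun u v => (hL.reachable_iff _ _).2 ?_⟩, hL.acyclic⟩
      obtain ⟨i, hi⟩ := hb u
      obtain ⟨j, hj⟩ := hb v
      rw [hi, hj, h i j]
  | cons e es ih =>
    obtain ⟨i, j, c⟩ := e
    simp only [List.map_cons, List.nodup_cons] at hnd
    simp only [List.mem_cons, forall_eq_or_imp] at hes hS
    obtain ⟨⟨hij, hc⟩, hes⟩ := hes
    obtain ⟨hSe, hS⟩ := hS
    rw [List.map_cons, List.toFinset_cons, treeSum_insert w S (by simpa using hnd.1), networkSum,
      ih hes hnd.2 S L hL hb hS]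
    congr 1
    split_ifs with hlab
    -- The ends are already connected by `S`. The edge is neither a loop nor in `S`, so adding it
    -- closes a cycle.
    · rw [treeSum_eq_zero, mul_zero]
      rw [Finset.coe_insert, fromEdgeSet_insert, SimpleGraph.isAcyclic_sup_fromEdgeSet_iff]
      rintro ⟨-, h⟩
      rcases h ((hL.reachable_iff _ _).2 hlab) with h | h
      · exact hij h
      · exact hSe (by simpa using h.1)
    · rw [ih hes hnd.2 _ _ (hL.insert hlab)]
      · rw [hc]; rfl
      · intro u
        obtain ⟨l, hl⟩ := hb u
        exact ⟨l, by simp only [mergeLabel, hl]⟩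
      · intro e he h
        rcases Finset.mem_insert.1 h with h | h
        · exact hnd.1 (h ▸ List.mem_map_of_mem (f := fun e => s(b e.1, b e.2.1)) he)
        · exact hS e he h

/-! ### Elimination of the centre of a star in a small network -/

theorem mergeLabel_vec4 {κ : Type*} [DecidableEq κ] (a b c d : κ) (i j : Fin 4) :
    mergeLabel ![a, b, c, d] i j =
      ![if a = ![a, b, c, d] i then ![a, b, c, d] j else a,
        if b = ![a, b, c, d] i then ![a, b, c, d] j else b,
        if c = ![a, b, c, d] i then ![a, b, c, d] j else c,
        if d = ![a, b, c, d] i then ![a, b, c, d] j else d] := by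
  ext l; fin_cases l <;> rfl

theorem mergeLabel_vec5 {κ : Type*} [DecidableEq κ] (a b c d e : κ) (i j : Fin 5) :
    mergeLabel ![a, b, c, d, e] i j =
      ![if a = ![a, b, c, d, e] i then ![a, b, c, d, e] j else a,
        if b = ![a, b, c, d, e] i then ![a, b, c, d, e] j else b,
        if c = ![a, b, c, d, e] i then ![a, b, c, d, e] j else c,
        if d = ![a, b, c, d, e] i then ![a, b, c, d, e] j else d,
        if e = ![a, b, c, d, e] i then ![a, b, c, d, e] j else e] := by
  ext l; fin_cases l <;> rfl

set_option maxHeartbeats 4000000 in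
/-- Star-triangle transformation: a star with centre `4` and four branches, of weights `s i` and
`r`, with edges of weight `m i` between the ends of three branches and the end of the last, is
equivalent to a complete graph on the ends of the branches. -/
theorem networkSum_star {κ : Type*} [DecidableEq κ] (a b c d : κ)
    (m0 m1 m2 s0 s1 s2 r : ℝ) {C : ℝ} (hC : C ≠ 0) (hs : s0 + s1 + s2 + r = C) :
    networkSum [((0 : Fin 5), (3 : Fin 5), m0), (1, 3, m1), (2, 3, m2),
        (4, 0, s0), (4, 1, s1), (4, 2, s2), (4, 3, r)]
      ![some a, some b, some c, some d, none] =
    C * networkSum [((0 : Fin 4), (3 : Fin 4), m0 + s0 * r / C), (1, 3, m1 + s1 * r / C),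
        (2, 3, m2 + s2 * r / C), (0, 1, s0 * s1 / C), (1, 2, s1 * s2 / C),
        (0, 2, s0 * s2 / C)] ![a, b, c, d] := by
  obtain rfl : r = C - s0 - s1 - s2 := by linarith
  -- The sums depend only on which of the four labels coincide. Patterns violating transitivity are
  -- contradictory; each remaining partition leaves a rational identity with denominators powers of
  -- `C`.
  have key : ∀ u v : κ, u = v ∨ (u ≠ v ∧ v ≠ u) := fun u v =>
    (eq_or_ne u v).imp_right fun h => ⟨h, h.symm⟩
  rcases key a b with h01 | h01 <;> rcases key a c with h02 | h02 <;>
    rcases key a d with h03 | h03 <;> rcases key b c with h12 | h12 <;>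
    rcases key b d with h13 | h13 <;> rcases key c d with h23 | h23 <;>
    first
    | (exfalso; clear hC key; grind)
    | subst_vars; simp [networkSum, mergeLabel_vec4, mergeLabel_vec5, Fin.forall_fin_succ, *] <;>
      field_simp <;> ring

/-! ## The Jacobi elliptic functions: derivatives and addition formulas -/

section Elliptic

variable {k : ℝ}

theorem one_sub_sq_mul_sin_sq_pos (hk : k ∈ Set.Ico (0 : ℝ) 1) (τ : ℝ) :
    0 < 1 - k ^ 2 * Real.sin τ ^ 2 := by
  have h1 : Real.sin τ ^ 2 ≤ 1 := Real.sin_sq_le_one τ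
  have h2 : k ^ 2 < 1 := by nlinarith [hk.1, hk.2]
  nlinarith [sq_nonneg k, sq_nonneg (Real.sin τ)]

theorem complModulus_pos (hk : k ∈ Set.Ico (0 : ℝ) 1) : 0 < complModulus k :=
  Real.sqrt_pos.2 (by nlinarith [hk.1, hk.2])

theorem complModulus_sq (hk : k ∈ Set.Ico (0 : ℝ) 1) : complModulus k ^ 2 = 1 - k ^ 2 :=
  Real.sq_sqrt (by nlinarith [hk.1, hk.2])

theorem continuous_integrandF (hk : k ∈ Set.Ico (0 : ℝ) 1) :
    Continuous fun τ : ℝ => 1 / √(1 - k ^ 2 * Real.sin τ ^ 2) :=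
  continuous_const.div (by fun_prop) fun τ =>
    (Real.sqrt_pos.2 (one_sub_sq_mul_sin_sq_pos hk τ)).ne'

theorem hasDerivAt_ellipticF (hk : k ∈ Set.Ico (0 : ℝ) 1) (φ : ℝ) :
    HasDerivAt (ellipticF k) (1 / √(1 - k ^ 2 * Real.sin φ ^ 2)) φ :=
  intervalIntegral.integral_hasDerivAt_right ((continuous_integrandF hk).intervalIntegrable _ _)
    (continuous_integrandF hk).stronglyMeasurable.stronglyMeasurableAtFilter
    (continuous_integrandF hk).continuousAt

theorem ellipticF_strictMono (hk : k ∈ Set.Ico (0 : ℝ) 1) : StrictMono (ellipticF k) :=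
  strictMono_of_hasDerivAt_pos (hasDerivAt_ellipticF hk) fun φ =>
    one_div_pos.2 (Real.sqrt_pos.2 (one_sub_sq_mul_sin_sq_pos hk φ))

theorem ellipticF_jacobiAm (hk : k ∈ Set.Ico (0 : ℝ) 1) (u : ℝ) :
    ellipticF k (jacobiAm k u) = u :=
  Function.rightInverse_invFun (ellipticF_bijective hk).2 u

theorem jacobiAm_ellipticF (hk : k ∈ Set.Ico (0 : ℝ) 1) (φ : ℝ) :
    jacobiAm k (ellipticF k φ) = φ :=
  Function.leftInverse_invFun (ellipticF_bijective hk).1 φ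

theorem jacobiAm_strictMono (hk : k ∈ Set.Ico (0 : ℝ) 1) : StrictMono (jacobiAm k) := by
  intro u v huv
  rwa [← (ellipticF_strictMono hk).lt_iff_lt, ellipticF_jacobiAm hk, ellipticF_jacobiAm hk]

theorem hasDerivAt_jacobiAm (hk : k ∈ Set.Ico (0 : ℝ) 1) (u : ℝ) :
    HasDerivAt (jacobiAm k) (jacobiDn k u) u := by
  -- The derivative of an inverse function requires its continuity, which monotonicity and
  -- surjectivity provide.
  have hcont : Continuous (jacobiAm k) :=
    (jacobiAm_strictMono hk).monotone.continuous_of_surjective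
      fun φ => ⟨_, jacobiAm_ellipticF hk φ⟩
  have := HasDerivAt.of_local_left_inverse hcont.continuousAt
    (hasDerivAt_ellipticF hk (jacobiAm k u))
    (one_div_pos.2 (Real.sqrt_pos.2 (one_sub_sq_mul_sin_sq_pos hk _))).ne'
    (Filter.Eventually.of_forall (ellipticF_jacobiAm hk))
  simpa [jacobiDn, jacobiSn] using this

theorem jacobiDn_pos (hk : k ∈ Set.Ico (0 : ℝ) 1) (u : ℝ) : 0 < jacobiDn k u :=
  Real.sqrt_pos.2 (one_sub_sq_mul_sin_sq_pos hk _)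

theorem jacobiDn_sq (hk : k ∈ Set.Ico (0 : ℝ) 1) (u : ℝ) :
    jacobiDn k u ^ 2 = 1 - k ^ 2 * jacobiSn k u ^ 2 :=
  Real.sq_sqrt (one_sub_sq_mul_sin_sq_pos hk _).le

theorem jacobiCn_sq (k u : ℝ) : jacobiCn k u ^ 2 = 1 - jacobiSn k u ^ 2 := Real.cos_sq' _

theorem hasDerivAt_jacobiSn (hk : k ∈ Set.Ico (0 : ℝ) 1) (u : ℝ) :
    HasDerivAt (jacobiSn k) (jacobiCn k u * jacobiDn k u) u :=
  (hasDerivAt_jacobiAm hk u).sin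

theorem hasDerivAt_jacobiCn (hk : k ∈ Set.Ico (0 : ℝ) 1) (u : ℝ) :
    HasDerivAt (jacobiCn k) (-jacobiSn k u * jacobiDn k u) u :=
  (hasDerivAt_jacobiAm hk u).cos

theorem hasDerivAt_jacobiDn (hk : k ∈ Set.Ico (0 : ℝ) 1) (u : ℝ) :
    HasDerivAt (jacobiDn k) (-(k ^ 2 * jacobiSn k u * jacobiCn k u)) u := by
  have h := ((((hasDerivAt_jacobiSn hk u).pow 2).const_mul (k ^ 2)).const_sub 1).sqrt
    (one_sub_sq_mul_sin_sq_pos hk _).ne'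
  refine h.congr_deriv ?_
  change _ / (2 * jacobiDn k u) = _
  have := (jacobiDn_pos hk u).ne'
  field_simp
  norm_num
  ring

theorem ellipticF_zero (k : ℝ) : ellipticF k 0 = 0 := by simp [ellipticF]

theorem jacobiAm_zero (hk : k ∈ Set.Ico (0 : ℝ) 1) : jacobiAm k 0 = 0 := by
  simpa [ellipticF_zero] using jacobiAm_ellipticF hk 0

theorem jacobiAm_ellipticK (hk : k ∈ Set.Ico (0 : ℝ) 1) : jacobiAm k (ellipticK k) = π / 2 :=
  jacobiAm_ellipticF hk (π / 2)

theorem ellipticK_pos (hk : k ∈ Set.Ico (0 : ℝ) 1) : 0 < ellipticK k := by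
  have := ellipticF_strictMono hk (a := 0) (b := π / 2) (by positivity)
  rwa [ellipticF_zero] at this

theorem jacobiSn_zero (hk : k ∈ Set.Ico (0 : ℝ) 1) : jacobiSn k 0 = 0 := by
  simp [jacobiSn, jacobiAm_zero hk]

theorem jacobiCn_zero (hk : k ∈ Set.Ico (0 : ℝ) 1) : jacobiCn k 0 = 1 := by
  simp [jacobiCn, jacobiAm_zero hk]

theorem jacobiDn_zero (hk : k ∈ Set.Ico (0 : ℝ) 1) : jacobiDn k 0 = 1 := by
  simp [jacobiDn, jacobiSn_zero hk]

theorem jacobiSn_ellipticK (hk : k ∈ Set.Ico (0 : ℝ) 1) : jacobiSn k (ellipticK k) = 1 := by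
  simp [jacobiSn, jacobiAm_ellipticK hk]

theorem jacobiCn_ellipticK (hk : k ∈ Set.Ico (0 : ℝ) 1) : jacobiCn k (ellipticK k) = 0 := by
  simp [jacobiCn, jacobiAm_ellipticK hk]

theorem jacobiDn_ellipticK (hk : k ∈ Set.Ico (0 : ℝ) 1) :
    jacobiDn k (ellipticK k) = complModulus k := by
  simp [jacobiDn, jacobiSn_ellipticK hk, complModulus]

/-- If `h` is symmetric under `τ ↦ π - τ`, its primitive is symmetric about `π / 2`. -/
theorem integral_pi_sub {h : ℝ → ℝ} (hc : Continuous h) (hs : ∀ τ, h (π - τ) = h τ) (φ : ℝ) :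
    ∫ τ in (0 : ℝ)..(π - φ), h τ =
      2 * (∫ τ in (0 : ℝ)..(π / 2), h τ) - ∫ τ in (0 : ℝ)..φ, h τ := by
  have key : ∀ φ, (∫ τ in (0 : ℝ)..(π - φ), h τ) + ∫ τ in (0 : ℝ)..φ, h τ =
      ∫ τ in (0 : ℝ)..π, h τ := by
    intro φ
    have h1 : ∫ τ in (0 : ℝ)..φ, h τ = ∫ τ in (π - φ)..π, h τ := by
      have := intervalIntegral.integral_comp_sub_left h (a := 0) (b := φ) π
      simpa [hs] using this
    rw [h1]
    exact intervalIntegral.integral_add_adjacent_intervals (hc.intervalIntegrable _ _)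
      (hc.intervalIntegrable _ _)
  have h2 := key (π / 2)
  rw [show π - π / 2 = π / 2 by ring] at h2
  linarith [key φ]

theorem jacobiAm_two_mul_sub (hk : k ∈ Set.Ico (0 : ℝ) 1) (u : ℝ) :
    jacobiAm k (2 * ellipticK k - u) = π - jacobiAm k u := by
  refine (ellipticF_bijective hk).1 ?_
  have := integral_pi_sub (continuous_integrandF hk) (fun τ => by rw [Real.sin_pi_sub])
    (jacobiAm k u)
  rw [ellipticF_jacobiAm hk]
  change _ = ellipticF k _
  change ellipticF k _ = 2 * ellipticK k - ellipticF k _ at this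
  rw [this, ellipticF_jacobiAm hk]

theorem jacobiAm_neg (hk : k ∈ Set.Ico (0 : ℝ) 1) (u : ℝ) : jacobiAm k (-u) = -jacobiAm k u := by
  refine (ellipticF_bijective hk).1 ?_
  have := intervalIntegral.integral_comp_neg (fun τ => 1 / √(1 - k ^ 2 * Real.sin τ ^ 2))
    (a := 0) (b := jacobiAm k u)
  simp only [Real.sin_neg, neg_sq, neg_zero] at this
  rw [intervalIntegral.integral_symm 0 (-jacobiAm k u)] at this
  change ellipticF k _ = -ellipticF k (-jacobiAm k u) at this
  rw [ellipticF_jacobiAm hk] at this ⊢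
  linarith

theorem jacobiSn_two_mul_sub (hk : k ∈ Set.Ico (0 : ℝ) 1) (u : ℝ) :
    jacobiSn k (2 * ellipticK k - u) = jacobiSn k u := by
  rw [jacobiSn, jacobiAm_two_mul_sub hk, Real.sin_pi_sub]; rfl

theorem jacobiCn_two_mul_sub (hk : k ∈ Set.Ico (0 : ℝ) 1) (u : ℝ) :
    jacobiCn k (2 * ellipticK k - u) = -jacobiCn k u := by
  rw [jacobiCn, jacobiAm_two_mul_sub hk, Real.cos_pi_sub]; rfl

theorem jacobiDn_two_mul_sub (hk : k ∈ Set.Ico (0 : ℝ) 1) (u : ℝ) :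
    jacobiDn k (2 * ellipticK k - u) = jacobiDn k u := by
  rw [jacobiDn, jacobiSn_two_mul_sub hk]; rfl

theorem jacobiSn_neg (hk : k ∈ Set.Ico (0 : ℝ) 1) (u : ℝ) : jacobiSn k (-u) = -jacobiSn k u := by
  rw [jacobiSn, jacobiAm_neg hk, Real.sin_neg]; rfl

theorem jacobiCn_neg (hk : k ∈ Set.Ico (0 : ℝ) 1) (u : ℝ) : jacobiCn k (-u) = jacobiCn k u := by
  rw [jacobiCn, jacobiAm_neg hk, Real.cos_neg]; rfl

theorem jacobiDn_neg (hk : k ∈ Set.Ico (0 : ℝ) 1) (u : ℝ) : jacobiDn k (-u) = jacobiDn k u := by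
  rw [jacobiDn, jacobiSn_neg hk, neg_sq]; rfl

/-! ### Addition formulas for `sn`, `cn`, `dn` and quarter-period shifts -/

theorem one_sub_sq_mul_sn_sq_mul_sn_sq_pos (hk : k ∈ Set.Ico (0 : ℝ) 1) (u v : ℝ) :
    0 < 1 - k ^ 2 * jacobiSn k u ^ 2 * jacobiSn k v ^ 2 := by
  have h1 : jacobiSn k v ^ 2 ≤ 1 := Real.sin_sq_le_one _
  have h2 := one_sub_sq_mul_sin_sq_pos hk (jacobiAm k u)
  change 0 < 1 - k ^ 2 * jacobiSn k u ^ 2 at h2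
  nlinarith [mul_nonneg (sq_nonneg k) (sq_nonneg (jacobiSn k u))]

/-- The hypothesis says that `N / D` has zero derivative, so this quotient is constant and equal to
its value at `t₀`. -/
theorem eq_mul_of_deriv {N D : ℝ → ℝ} (hD : ∀ t, D t ≠ 0)
    (h : ∀ t, ∃ N' D', HasDerivAt N N' t ∧ HasDerivAt D D' t ∧ N' * D t = N t * D') (t t₀ : ℝ)
    (ht₀ : D t₀ = 1) : N t = N t₀ * D t := by
  have hd : ∀ t, HasDerivAt (fun t => N t / D t) 0 t := by
    intro t
    obtain ⟨N', D', hN', hD', heq⟩ := h t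
    refine (hN'.div hD' (hD t)).congr_deriv ?_
    rw [heq, sub_self, zero_div]
  have := is_const_of_deriv_eq_zero (fun t => (hd t).differentiableAt) (fun t => (hd t).deriv) t t₀
  simp only [ht₀, div_one] at this
  rw [← this, div_mul_cancel₀ _ (hD t)]

theorem HasDerivAt.comp_const_sub' {f : ℝ → ℝ} {f' c t : ℝ} (h : HasDerivAt f f' (c - t)) :
    HasDerivAt (fun t => f (c - t)) (-f') t := by
  simpa using h.comp_const_sub c t

theorem jacobi_add (hk : k ∈ Set.Ico (0 : ℝ) 1) (u v : ℝ) :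
    (jacobiSn k u * jacobiCn k v * jacobiDn k v + jacobiSn k v * jacobiCn k u * jacobiDn k u =
      jacobiSn k (u + v) * (1 - k ^ 2 * jacobiSn k u ^ 2 * jacobiSn k v ^ 2)) ∧
    (jacobiCn k u * jacobiCn k v - jacobiSn k u * jacobiSn k v * jacobiDn k u * jacobiDn k v =
      jacobiCn k (u + v) * (1 - k ^ 2 * jacobiSn k u ^ 2 * jacobiSn k v ^ 2)) ∧
    (jacobiDn k u * jacobiDn k v -
        k ^ 2 * jacobiSn k u * jacobiSn k v * jacobiCn k u * jacobiCn k v =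
      jacobiDn k (u + v) * (1 - k ^ 2 * jacobiSn k u ^ 2 * jacobiSn k v ^ 2)) := by
  -- With the sum `c` of the arguments fixed, each numerator over the common denominator is constant
  -- in `u`. At `u = 0` the denominator is `1` and the numerator is `sn c`, `cn c` or `dn c`.
  obtain ⟨c, rfl⟩ : ∃ c, v = c - u := ⟨u + v, by ring⟩
  rw [show u + (c - u) = c by ring]
  have hD : ∀ t, (1 - k ^ 2 * jacobiSn k t ^ 2 * jacobiSn k (c - t) ^ 2) ≠ 0 := fun t =>
    (one_sub_sq_mul_sn_sq_mul_sn_sq_pos hk _ _).ne'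
  have hs1 := hasDerivAt_jacobiSn hk
  have hc1 := hasDerivAt_jacobiCn hk
  have hd1 := hasDerivAt_jacobiDn hk
  have hs2 := fun t => (hasDerivAt_jacobiSn hk (c - t)).comp_const_sub'
  have hc2 := fun t => (hasDerivAt_jacobiCn hk (c - t)).comp_const_sub'
  have hd2 := fun t => (hasDerivAt_jacobiDn hk (c - t)).comp_const_sub'
  have hDd := fun t => ((((hs1 t).pow 2).const_mul (k ^ 2)).mul ((hs2 t).pow 2)).const_sub 1
  have h0 : 1 - k ^ 2 * jacobiSn k 0 ^ 2 * jacobiSn k (c - 0) ^ 2 = 1 := by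
    simp [jacobiSn_zero hk]
  refine ⟨?_, ?_, ?_⟩
  · have := eq_mul_of_deriv (N := fun t => jacobiSn k t * jacobiCn k (c - t) * jacobiDn k (c - t) +
      jacobiSn k (c - t) * jacobiCn k t * jacobiDn k t) hD (fun t => ⟨_, _,
        (((hs1 t).mul (hc2 t)).mul (hd2 t)).add (((hs2 t).mul (hc1 t)).mul (hd1 t)), hDd t, ?_⟩)
        u 0 h0
    · simpa [jacobiSn_zero hk, jacobiCn_zero hk, jacobiDn_zero hk] using this
    · have e1 := jacobiCn_sq k t
      have e2 := jacobiCn_sq k (c - t)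
      have e3 := jacobiDn_sq hk t
      have e4 := jacobiDn_sq hk (c - t)
      simp only [Pi.mul_apply, Pi.pow_apply]
      generalize jacobiSn k t = s1 at *
      generalize jacobiCn k t = c1 at *
      generalize jacobiDn k t = d1 at *
      generalize jacobiSn k (c - t) = s2 at *
      generalize jacobiCn k (c - t) = c2 at *
      generalize jacobiDn k (c - t) = d2 at *
      clear * - e1 e2 e3 e4
      grind
  · have := eq_mul_of_deriv (N := fun t => jacobiCn k t * jacobiCn k (c - t) -
      jacobiSn k t * jacobiSn k (c - t) * jacobiDn k t * jacobiDn k (c - t)) hD (fun t => ⟨_, _,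
        ((hc1 t).mul (hc2 t)).sub ((((hs1 t).mul (hs2 t)).mul (hd1 t)).mul (hd2 t)), hDd t, ?_⟩)
        u 0 h0
    · simpa [jacobiSn_zero hk, jacobiCn_zero hk, jacobiDn_zero hk] using this
    · have e1 := jacobiCn_sq k t
      have e2 := jacobiCn_sq k (c - t)
      have e3 := jacobiDn_sq hk t
      have e4 := jacobiDn_sq hk (c - t)
      simp only [Pi.mul_apply, Pi.pow_apply]
      generalize jacobiSn k t = s1 at *
      generalize jacobiCn k t = c1 at *
      generalize jacobiDn k t = d1 at *
      generalize jacobiSn k (c - t) = s2 at *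
      generalize jacobiCn k (c - t) = c2 at *
      generalize jacobiDn k (c - t) = d2 at *
      clear * - e1 e2 e3 e4
      grind
  · have := eq_mul_of_deriv (N := fun t => jacobiDn k t * jacobiDn k (c - t) -
      k ^ 2 * jacobiSn k t * jacobiSn k (c - t) * jacobiCn k t * jacobiCn k (c - t)) hD
      (fun t => ⟨_, _, ((hd1 t).mul (hd2 t)).sub
        (((((hs1 t).const_mul (k ^ 2)).mul (hs2 t)).mul (hc1 t)).mul (hc2 t)), hDd t, ?_⟩)
        u 0 h0
    · simpa [jacobiSn_zero hk, jacobiCn_zero hk, jacobiDn_zero hk] using this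
    · have e1 := jacobiCn_sq k t
      have e2 := jacobiCn_sq k (c - t)
      have e3 := jacobiDn_sq hk t
      have e4 := jacobiDn_sq hk (c - t)
      simp only [Pi.mul_apply, Pi.pow_apply]
      generalize jacobiSn k t = s1 at *
      generalize jacobiCn k t = c1 at *
      generalize jacobiDn k t = d1 at *
      generalize jacobiSn k (c - t) = s2 at *
      generalize jacobiCn k (c - t) = c2 at *
      generalize jacobiDn k (c - t) = d2 at *
      clear * - e1 e2 e3 e4
      grind

theorem jacobiSn_ellipticK_sub (hk : k ∈ Set.Ico (0 : ℝ) 1) (u : ℝ) :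
    jacobiSn k (ellipticK k - u) = jacobiCn k u / jacobiDn k u := by
  have h := (jacobi_add hk (ellipticK k) (-u)).1
  rw [jacobiSn_ellipticK hk, jacobiCn_ellipticK hk, jacobiSn_neg hk, jacobiCn_neg hk,
    jacobiDn_neg hk, neg_sq, one_pow, mul_one, ← jacobiDn_sq hk, ← sub_eq_add_neg] at h
  have := (jacobiDn_pos hk u).ne'
  field_simp
  apply mul_right_cancel₀ this
  linarith

theorem jacobiCn_ellipticK_sub (hk : k ∈ Set.Ico (0 : ℝ) 1) (u : ℝ) :
    jacobiCn k (ellipticK k - u) = complModulus k * jacobiSn k u / jacobiDn k u := by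
  have h := (jacobi_add hk (ellipticK k) (-u)).2.1
  rw [jacobiSn_ellipticK hk, jacobiCn_ellipticK hk, jacobiSn_neg hk, jacobiCn_neg hk,
    jacobiDn_ellipticK hk,
    jacobiDn_neg hk, neg_sq, one_pow, mul_one, ← jacobiDn_sq hk, ← sub_eq_add_neg] at h
  have := (jacobiDn_pos hk u).ne'
  field_simp
  apply mul_right_cancel₀ this
  linarith

theorem jacobiSc_ellipticK_sub (hk : k ∈ Set.Ico (0 : ℝ) 1) (u : ℝ) :
    jacobiSc k (ellipticK k - u) = 1 / (complModulus k * jacobiSc k u) := by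
  have := (jacobiDn_pos hk u).ne'
  rw [jacobiSc, jacobiSn_ellipticK_sub hk, jacobiCn_ellipticK_sub hk, jacobiSc,
    div_div_div_cancel_right₀ this, ← mul_div_assoc, one_div_div]

theorem jacobiAm_mem_Ioo (hk : k ∈ Set.Ico (0 : ℝ) 1) {u : ℝ} (hu : u ∈ Set.Ioo 0 (ellipticK k)) :
    jacobiAm k u ∈ Set.Ioo 0 (π / 2) := by
  rw [← jacobiAm_ellipticK hk, Set.mem_Ioo, (jacobiAm_strictMono hk).lt_iff_lt]
  refine ⟨?_, hu.2⟩
  simpa [jacobiAm_zero hk] using jacobiAm_strictMono hk hu.1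

theorem jacobiSn_pos (hk : k ∈ Set.Ico (0 : ℝ) 1) {u : ℝ} (hu : u ∈ Set.Ioo 0 (ellipticK k)) :
    0 < jacobiSn k u := by
  have := jacobiAm_mem_Ioo hk hu
  exact Real.sin_pos_of_pos_of_lt_pi this.1 (by linarith [this.2, Real.pi_pos])

theorem jacobiCn_pos (hk : k ∈ Set.Ico (0 : ℝ) 1) {u : ℝ} (hu : u ∈ Set.Ioo 0 (ellipticK k)) :
    0 < jacobiCn k u := by
  have := jacobiAm_mem_Ioo hk hu
  exact Real.cos_pos_of_mem_Ioo ⟨by linarith [this.1, Real.pi_pos], this.2⟩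

theorem jacobiSc_pos (hk : k ∈ Set.Ico (0 : ℝ) 1) {u : ℝ} (hu : u ∈ Set.Ioo 0 (ellipticK k)) :
    0 < jacobiSc k u :=
  div_pos (jacobiSn_pos hk hu) (jacobiCn_pos hk hu)

/-- Jacobi's epsilon function `∫₀^u dn²`, as an incomplete elliptic integral of the second kind. -/
def jacobiEpsilon (k u : ℝ) : ℝ :=
  ∫ τ in (0 : ℝ)..jacobiAm k u, √(1 - k ^ 2 * Real.sin τ ^ 2)

theorem hasDerivAt_jacobiEpsilon (hk : k ∈ Set.Ico (0 : ℝ) 1) (u : ℝ) :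
    HasDerivAt (jacobiEpsilon k) (jacobiDn k u ^ 2) u := by
  have hc : Continuous fun τ : ℝ => √(1 - k ^ 2 * Real.sin τ ^ 2) := by fun_prop
  have h : HasDerivAt (fun φ => ∫ τ in (0 : ℝ)..φ, √(1 - k ^ 2 * Real.sin τ ^ 2))
      (√(1 - k ^ 2 * Real.sin (jacobiAm k u) ^ 2)) (jacobiAm k u) :=
    intervalIntegral.integral_hasDerivAt_right (hc.intervalIntegrable _ _)
      hc.stronglyMeasurable.stronglyMeasurableAtFilter hc.continuousAt
  exact (h.comp u (hasDerivAt_jacobiAm hk u)).congr_deriv (sq (jacobiDn k u)).symm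

theorem jacobiEpsilon_zero (hk : k ∈ Set.Ico (0 : ℝ) 1) : jacobiEpsilon k 0 = 0 := by
  simp [jacobiEpsilon, jacobiAm_zero hk]

theorem jacobiEpsilon_two_mul_sub (hk : k ∈ Set.Ico (0 : ℝ) 1) (u : ℝ) :
    jacobiEpsilon k (2 * ellipticK k - u) = 2 * ellipticE k - jacobiEpsilon k u := by
  rw [jacobiEpsilon, jacobiAm_two_mul_sub hk, integral_pi_sub (by fun_prop)
    (fun τ => by rw [Real.sin_pi_sub])]
  rfl

/-- With `c = u + v` fixed, the difference of the two sides has zero derivative in `u`, by the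
addition formula for `sn`; it vanishes at `u = 0`. -/
theorem jacobiEpsilon_add (hk : k ∈ Set.Ico (0 : ℝ) 1) (u v : ℝ) :
    jacobiEpsilon k u + jacobiEpsilon k v = jacobiEpsilon k (u + v) +
      k ^ 2 * jacobiSn k u * jacobiSn k v * jacobiSn k (u + v) := by
  obtain ⟨c, rfl⟩ : ∃ c, v = c - u := ⟨u + v, by ring⟩
  rw [show u + (c - u) = c by ring]
  have hd : ∀ t, HasDerivAt (fun t => jacobiEpsilon k t + jacobiEpsilon k (c - t) -
      k ^ 2 * jacobiSn k t * jacobiSn k (c - t) * jacobiSn k c) 0 t := by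
    intro t
    have h := ((hasDerivAt_jacobiEpsilon hk t).add
      (hasDerivAt_jacobiEpsilon hk (c - t)).comp_const_sub').sub
      ((((hasDerivAt_jacobiSn hk t).const_mul (k ^ 2)).mul
        (hasDerivAt_jacobiSn hk (c - t)).comp_const_sub').mul_const (jacobiSn k c))
    refine h.congr_deriv ?_
    have e := (jacobi_add hk t (c - t)).1
    rw [show t + (c - t) = c by ring] at e
    have e0 := (one_sub_sq_mul_sn_sq_mul_sn_sq_pos hk t (c - t)).ne'
    have e1 := jacobiCn_sq k t
    have e2 := jacobiCn_sq k (c - t)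
    have e3 := jacobiDn_sq hk t
    have e4 := jacobiDn_sq hk (c - t)
    generalize jacobiSn k t = s1 at *
    generalize jacobiCn k t = c1 at *
    generalize jacobiDn k t = d1 at *
    generalize jacobiSn k (c - t) = s2 at *
    generalize jacobiCn k (c - t) = c2 at *
    generalize jacobiDn k (c - t) = d2 at *
    generalize jacobiSn k c = s at *
    apply mul_right_cancel₀ e0
    clear * - e e1 e2 e3 e4
    linear_combination (1 - k ^ 2 * s1 ^ 2 * s2 ^ 2) * (e3 - e4) +
      k ^ 2 * (c1 * d1 * s2 - s1 * c2 * d2) * e -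
      k ^ 2 * (s2 ^ 2 * (d1 ^ 2 * e1 + (1 - s1 ^ 2) * e3) -
        s1 ^ 2 * (d2 ^ 2 * e2 + (1 - s2 ^ 2) * e4))
  have := is_const_of_deriv_eq_zero (fun t => (hd t).differentiableAt) (fun t => (hd t).deriv) u 0
  simp only [jacobiEpsilon_zero hk, jacobiSn_zero hk, sub_zero] at this
  linarith

/-- The term in `k ^ 2` is the defect of additivity of `jacobiEpsilon`; what remains on the right is
the defect of additivity of `regularA`. -/
theorem jacobiSc_mul_jacobiDn_add (hk : k ∈ Set.Ico (0 : ℝ) 1) {u v : ℝ} (hu : jacobiCn k u ≠ 0)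
    (hv : jacobiCn k v ≠ 0) (huv : jacobiCn k (u + v) ≠ 0) :
    jacobiSc k (u + v) * jacobiDn k (u + v) - jacobiSc k u * jacobiDn k u -
      jacobiSc k v * jacobiDn k v + k ^ 2 * jacobiSn k u * jacobiSn k v * jacobiSn k (u + v) =
    complModulus k ^ 2 * (jacobiSc k u * jacobiSc k v * jacobiSc k (u + v)) := by
  obtain ⟨es, ec, ed⟩ := jacobi_add hk u v
  have e0 := (one_sub_sq_mul_sn_sq_mul_sn_sq_pos hk u v).ne'
  have e1 := jacobiCn_sq k u
  have e2 := jacobiCn_sq k v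
  have e3 := jacobiDn_sq hk u
  have e4 := jacobiDn_sq hk v
  rw [complModulus_sq hk]
  unfold jacobiSc
  generalize jacobiSn k u = s1 at *
  generalize jacobiCn k u = c1 at *
  generalize jacobiDn k u = d1 at *
  generalize jacobiSn k v = s2 at *
  generalize jacobiCn k v = c2 at *
  generalize jacobiDn k v = d2 at *
  generalize jacobiSn k (u + v) = s at *
  generalize jacobiCn k (u + v) = c at *
  generalize jacobiDn k (u + v) = d at *
  have h1 : d + k ^ 2 * s1 * s2 * c = d1 * d2 := by
    apply mul_right_cancel₀ e0
    linear_combination -ed - k ^ 2 * s1 * s2 * ec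
  -- An alternative form of the addition formula for `sc`, with denominator `c1 c2 d1 d2 - k'² s1
  -- s2`.
  have h2 : s * (c1 * c2 * d1 * d2 - (1 - k ^ 2) * s1 * s2) =
      c * (s1 * d1 * c2 + s2 * d2 * c1) := by
    apply mul_right_cancel₀ e0
    linear_combination (s1 * d1 * c2 + s2 * d2 * c1) * ec -
      (c1 * c2 * d1 * d2 - (1 - k ^ 2) * s1 * s2) * es +
      s2 * c2 * d2 * (d1 ^ 2 * e1 + e3 - e1) + s1 * c1 * d1 * (d2 ^ 2 * e2 + e4 - e2)
  field_simp
  linear_combination h2 + s * c1 * c2 * h1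

/-- The regularisation of `∫₀^u dc²` which is defined for all `u`, up to the factor `k'`. -/
def regularA (k u : ℝ) : ℝ :=
  jacobiSc k u * jacobiDn k u - jacobiEpsilon k u + ellipticE k / ellipticK k * u

theorem regularA_add (hk : k ∈ Set.Ico (0 : ℝ) 1) {u v : ℝ} (hu : jacobiCn k u ≠ 0)
    (hv : jacobiCn k v ≠ 0) (huv : jacobiCn k (u + v) ≠ 0) :
    regularA k (u + v) = regularA k u + regularA k v +
      complModulus k ^ 2 * (jacobiSc k u * jacobiSc k v * jacobiSc k (u + v)) := by
  rw [← jacobiSc_mul_jacobiDn_add hk hu hv huv]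
  have := jacobiEpsilon_add hk u v
  unfold regularA
  linear_combination this

theorem jacobiSc_two_mul_sub (hk : k ∈ Set.Ico (0 : ℝ) 1) (u : ℝ) :
    jacobiSc k (2 * ellipticK k - u) = -jacobiSc k u := by
  rw [jacobiSc, jacobiSn_two_mul_sub hk, jacobiCn_two_mul_sub hk, div_neg]; rfl

theorem regularA_two_mul_sub (hk : k ∈ Set.Ico (0 : ℝ) 1) (u : ℝ) :
    regularA k (2 * ellipticK k - u) = -regularA k u := by
  have := (ellipticK_pos hk).ne'
  rw [regularA, jacobiSc_two_mul_sub hk, jacobiDn_two_mul_sub hk, jacobiEpsilon_two_mul_sub hk,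
    regularA]
  field_simp
  ring

theorem ellipticA_eq (hk : k ∈ Set.Ico (0 : ℝ) 1) {u : ℝ} (hu : u ∈ Set.Ioo 0 (ellipticK k)) :
    ellipticA k u = regularA k u / complModulus k := by
  have hcn : ∀ v ∈ Set.uIcc 0 u, jacobiCn k v ≠ 0 := by
    intro v hv
    rw [Set.uIcc_of_le hu.1.le] at hv
    rcases hv.1.eq_or_lt with rfl | h
    · simp [jacobiCn_zero hk]
    · exact (jacobiCn_pos hk ⟨h, hv.2.trans_lt hu.2⟩).ne'
  -- A primitive of `dc²`: `sc' dn = dc²`, while `sc dn' = -k² sn²` cancels `1 - dn² = k² sn²`.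
  have hd : ∀ v ∈ Set.uIcc 0 u, HasDerivAt
      (fun v => jacobiSc k v * jacobiDn k v - jacobiEpsilon k v + v) (jacobiDc k v ^ 2) v := by
    intro v hv
    have h := ((((hasDerivAt_jacobiSn hk v).div (hasDerivAt_jacobiCn hk v) (hcn v hv)).mul
      (hasDerivAt_jacobiDn hk v)).sub (hasDerivAt_jacobiEpsilon hk v)).add (hasDerivAt_id v)
    refine h.congr_deriv ?_
    have e1 := jacobiCn_sq k v
    have e3 := jacobiDn_sq hk v
    have := hcn v hv
    simp only [Pi.div_apply, jacobiDc]
    field_simp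
    grind
  have hint : IntervalIntegrable (fun v => jacobiDc k v ^ 2) MeasureTheory.volume 0 u := by
    refine ContinuousOn.intervalIntegrable fun v hv => ContinuousAt.continuousWithinAt ?_
    exact ((hasDerivAt_jacobiDn hk v).continuousAt.div (hasDerivAt_jacobiCn hk v).continuousAt
      (hcn v hv)).pow 2
  have hK := (ellipticK_pos hk).ne'
  rw [ellipticA, intervalIntegral.integral_eq_sub_of_hasDerivAt hd hint, regularA]
  simp only [jacobiEpsilon_zero hk, jacobiSc, jacobiSn_zero hk]
  field_simp
  ring

theorem ellipticA_add (hk : k ∈ Set.Ico (0 : ℝ) 1) {u v : ℝ} (hu : u ∈ Set.Ioo 0 (ellipticK k))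
    (hv : v ∈ Set.Ioo 0 (ellipticK k)) (huv : u + v ∈ Set.Ioo 0 (ellipticK k)) :
    ellipticA k (u + v) = ellipticA k u + ellipticA k v +
      complModulus k * (jacobiSc k u * jacobiSc k v * jacobiSc k (u + v)) := by
  have := (complModulus_pos hk).ne'
  rw [ellipticA_eq hk hu, ellipticA_eq hk hv, ellipticA_eq hk huv,
    regularA_add hk (jacobiCn_pos hk hu).ne' (jacobiCn_pos hk hv).ne' (jacobiCn_pos hk huv).ne']
  field_simp

/-- Here `u + v = 2K - w` lies beyond the pole of `dc` at `K`, where the integral defining `A` is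
unusable. The function `regularA` still satisfies the addition formula there and, like `sc`, changes
sign under `u ↦ 2K - u`. -/
theorem ellipticA_add_add (hk : k ∈ Set.Ico (0 : ℝ) 1) {u v w : ℝ}
    (hu : u ∈ Set.Ioo 0 (ellipticK k)) (hv : v ∈ Set.Ioo 0 (ellipticK k))
    (hw : w ∈ Set.Ioo 0 (ellipticK k)) (huvw : u + v + w = 2 * ellipticK k) :
    ellipticA k u + ellipticA k v + ellipticA k w =
      complModulus k * (jacobiSc k u * jacobiSc k v * jacobiSc k w) := by
  have := (complModulus_pos hk).ne'
  have huv : u + v = 2 * ellipticK k - w := by linarith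
  have h := regularA_add hk (jacobiCn_pos hk hu).ne' (jacobiCn_pos hk hv).ne' (by
    rw [huv, jacobiCn_two_mul_sub hk]
    exact neg_ne_zero.2 (jacobiCn_pos hk hw).ne')
  rw [huv, regularA_two_mul_sub hk, jacobiSc_two_mul_sub hk] at h
  rw [ellipticA_eq hk hu, ellipticA_eq hk hv, ellipticA_eq hk hw]
  field_simp
  linarith

/-- The mass at an end of a branch, in the star-triangle transformation. -/
theorem ellipticA_star (hk : k ∈ Set.Ico (0 : ℝ) 1) {u v w : ℝ}
    (hu : u ∈ Set.Ioo 0 (ellipticK k)) (hv : v ∈ Set.Ioo 0 (ellipticK k))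
    (hw : w ∈ Set.Ioo 0 (ellipticK k)) (huvw : u + v + w = 2 * ellipticK k) :
    ellipticA k u = ellipticA k (ellipticK k - v) + ellipticA k (ellipticK k - w) +
      jacobiSc k u / (complModulus k * (jacobiSc k v * jacobiSc k w)) := by
  have := (complModulus_pos hk).ne'
  have h : u = (ellipticK k - v) + (ellipticK k - w) := by linarith
  have h' := ellipticA_add hk (u := ellipticK k - v) (v := ellipticK k - w)
    ⟨by linarith [hv.2], by linarith [hv.1]⟩ ⟨by linarith [hw.2], by linarith [hw.1]⟩ (h ▸ hu)
  rw [← h, jacobiSc_ellipticK_sub hk, jacobiSc_ellipticK_sub hk] at h'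
  rw [h']
  have := (jacobiSc_pos hk hv).ne'
  have := (jacobiSc_pos hk hw).ne'
  field_simp

end Elliptic

/-! ## The angles and the masses in a star-triangle transformation -/

theorem norm_exp_sub_exp (a b : ℝ) :
    ‖Complex.exp (a * Complex.I) - Complex.exp (b * Complex.I)‖ = 2 * |Real.sin ((a - b) / 2)| := by
  have h : Complex.exp (a * Complex.I) - Complex.exp (b * Complex.I) =
      Complex.exp (b * Complex.I) * (Complex.exp (Complex.I * (a - b : ℝ)) - 1) := by
    rw [mul_sub, ← Complex.exp_add, mul_one]
    congr 2
    push_cast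
    ring
  rw [h, norm_mul, Complex.norm_exp_ofReal_mul_I, one_mul, Complex.norm_exp_I_mul_ofReal_sub_one,
    Real.norm_eq_abs, abs_mul, abs_two]

theorem norm_exp_add_exp (a b : ℝ) :
    ‖Complex.exp (a * Complex.I) + Complex.exp (b * Complex.I)‖ = 2 * |Real.cos ((b - a) / 2)| := by
  have h : Complex.exp (a * Complex.I) =
      -Complex.exp ((a + π : ℝ) * Complex.I) := by
    push_cast
    rw [add_mul, Complex.exp_add, Complex.exp_pi_mul_I]
    ring
  rw [h, neg_add_eq_sub, norm_exp_sub_exp, ← Real.sin_pi_div_two_sub, ← abs_neg,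
    ← Real.sin_neg, abs_eq_abs.2]
  left
  congr 1
  ring

theorem arccos_half_mul_abs_cos {t : ℝ} (h0 : 0 < t) (h1 : t < π / 2) :
    Real.arccos (2 * |Real.cos t| / 2) = t := by
  rw [mul_div_cancel_left₀ _ two_ne_zero, abs_of_pos (Real.cos_pos_of_mem_Ioo ⟨by linarith, h1⟩),
    Real.arccos_cos h0.le (by linarith)]

theorem arccos_half_mul_abs_sin {t : ℝ} (h0 : 0 < t) (h1 : t < π / 2) :
    Real.arccos (2 * |Real.sin t| / 2) = π / 2 - t := by
  rw [← Real.cos_pi_div_two_sub, arccos_half_mul_abs_cos (by linarith) (by linarith)]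

section StarTriangle

variable {V : Type*} {Gs : IsoradialGraph (Option V)} {Gt : IsoradialGraph V} {x : Fin 3 → V}

theorem IsStarTriangle.exists_halfAngle (h : IsStarTriangle Gs Gt x) :
    ∃ t : Fin 3 → ℝ, (∀ i, 0 < t i ∧ t i < π / 2) ∧ t 0 + t 1 + t 2 = π ∧
      (∀ i, Gs.halfAngle none (some (x i)) = t i) ∧
      Gt.halfAngle (x 0) (x 1) = π / 2 - t 2 ∧ Gt.halfAngle (x 1) (x 2) = π / 2 - t 0 ∧
      Gt.halfAngle (x 0) (x 2) = π / 2 - t 1 := by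
  obtain ⟨α, β, γ, ⟨h1, h1'⟩, ⟨h2, h2'⟩, ⟨h3, h3'⟩, hx0, hx1, hx2⟩ := h.rhombi
  -- The third rhombus closes the turn, so its second vector has argument `α + 2π`; halving shifts
  -- by `π`, which absolute values ignore.
  have hs2 : |Real.sin ((α - γ) / 2)| = |Real.sin ((α + 2 * π - γ) / 2)| := by
    rw [show (α + 2 * π - γ) / 2 = (α - γ) / 2 + π by ring, Real.sin_add_pi, abs_neg]
  have hc2 : |Real.cos ((α - γ) / 2)| = |Real.cos ((α + 2 * π - γ) / 2)| := by
    rw [show (α + 2 * π - γ) / 2 = (α - γ) / 2 + π by ring, Real.cos_add_pi, abs_neg]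
  have hs0 : |Real.sin ((γ - β) / 2)| = |Real.sin ((β - γ) / 2)| := by
    rw [← abs_neg, ← Real.sin_neg]; congr 2; ring
  refine ⟨![(β - α) / 2, (γ - β) / 2, (α + 2 * π - γ) / 2], ?_, ?_, ?_, ?_, ?_, ?_⟩
  · simp only [Fin.forall_fin_succ, Fin.forall_fin_zero, Matrix.cons_val, Fin.succ_zero_eq_one,
      Fin.succ_one_eq_two]
    refine ⟨⟨?_, ?_⟩, ⟨?_, ?_⟩, ⟨?_, ?_⟩, trivial⟩ <;> linarith
  · simp only [Matrix.cons_val]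
    ring
  · simp only [Fin.forall_fin_succ, Fin.forall_fin_zero, Matrix.cons_val, Fin.succ_zero_eq_one,
      Fin.succ_one_eq_two, IsoradialGraph.halfAngle, dist_eq_norm]
    refine ⟨?_, ?_, ?_, trivial⟩
    · rw [hx0, norm_sub_rev, add_assoc, add_sub_cancel_left, norm_exp_add_exp,
        arccos_half_mul_abs_cos] <;> linarith
    · rw [hx1, norm_sub_rev, add_assoc, add_sub_cancel_left, norm_exp_add_exp,
        arccos_half_mul_abs_cos] <;> linarith
    · rw [hx2, norm_sub_rev, add_assoc, add_sub_cancel_left, norm_exp_add_exp, hc2,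
        arccos_half_mul_abs_cos] <;> linarith
  -- The vector shared by the two rhombi cancels: a triangle edge is a translate of the second
  -- diagonal of the third rhombus, whence the complementary half-angle.
  · rw [IsoradialGraph.halfAngle, dist_eq_norm, ← h.pos_eq, ← h.pos_eq, hx0, hx1]
    rw [show ∀ p a b c : ℂ, p + a + b - (p + b + c) = a - c by intros; ring, norm_exp_sub_exp, hs2,
      arccos_half_mul_abs_sin (by linarith) (by linarith)]
    simp only [Matrix.cons_val]
  · rw [IsoradialGraph.halfAngle, dist_eq_norm, ← h.pos_eq, ← h.pos_eq, hx1, hx2]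
    rw [show ∀ p a b c : ℂ, p + a + b - (p + b + c) = a - c by intros; ring, norm_exp_sub_exp,
      arccos_half_mul_abs_sin (by linarith) (by linarith)]
    simp only [Matrix.cons_val]
  · rw [IsoradialGraph.halfAngle, dist_eq_norm, ← h.pos_eq, ← h.pos_eq, hx0, hx2]
    rw [show ∀ p a b c : ℂ, p + a + b - (p + c + a) = b - c by intros; ring, norm_exp_sub_exp,
      ← hs0, arccos_half_mul_abs_sin (by linarith) (by linarith)]
    simp only [Matrix.cons_val]

theorem IsStarTriangle.angles (h : IsStarTriangle Gs Gt x) {k : ℝ} (hk : k ∈ Set.Ico (0 : ℝ) 1) :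
    ∃ θ : Fin 3 → ℝ, (∀ i, θ i ∈ Set.Ioo 0 (ellipticK k)) ∧
      θ 0 + θ 1 + θ 2 = 2 * ellipticK k ∧
      (∀ i, Gs.angle k none (some (x i)) = θ i) ∧
      Gt.angle k (x 0) (x 1) = ellipticK k - θ 2 ∧ Gt.angle k (x 1) (x 2) = ellipticK k - θ 0 ∧
      Gt.angle k (x 0) (x 2) = ellipticK k - θ 1 := by
  obtain ⟨t, ht, hsum, hs, h01, h12, h02⟩ := h.exists_halfAngle
  have hK := ellipticK_pos hk
  have hpi := Real.pi_pos
  refine ⟨fun i => t i * (2 * ellipticK k / π), fun i => ⟨?_, ?_⟩, ?_, fun i => ?_, ?_, ?_, ?_⟩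
  · have := (ht i).1
    positivity
  · calc t i * (2 * ellipticK k / π) < π / 2 * (2 * ellipticK k / π) := by
          gcongr; exact (ht i).2
      _ = ellipticK k := by field_simp
  · rw [← add_mul, ← add_mul, hsum]; field_simp
  · rw [IsoradialGraph.angle, hs]
  · rw [IsoradialGraph.angle, h01]; field_simp
  · rw [IsoradialGraph.angle, h12]; field_simp
  · rw [IsoradialGraph.angle, h02]; field_simp

theorem IsStarTriangle.angle_some (h : IsStarTriangle Gs Gt x) (k : ℝ) (u v : V) :
    Gs.angle k (some u) (some v) = Gt.angle k u v := by
  simp only [IsoradialGraph.angle, IsoradialGraph.halfAngle, h.pos_eq]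

theorem IsStarTriangle.massSq_none [Fintype V] (h : IsStarTriangle Gs Gt x) (k : ℝ) :
    Gs.massSq k none = ∑ i, (ellipticA k (Gs.angle k none (some (x i))) -
      jacobiSc k (Gs.angle k none (some (x i)))) := by
  classical
  rw [IsoradialGraph.massSq, Finset.sum_filter, Fintype.sum_option, if_neg (Gs.graph.irrefl),
    zero_add, ← Finset.sum_filter]
  simp only [h.star_adj]
  rw [← Finset.sum_image (s := Finset.univ) (g := x) (f := fun v =>
    ellipticA k (Gs.angle k none (some v)) - jacobiSc k (Gs.angle k none (some v)))
    h.injective.injOn]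
  refine Finset.sum_congr ?_ fun _ _ => rfl
  ext v
  simp [eq_comm]

-- At `x i` the move replaces the edge to the centre by two triangle edges; all other edges keep
-- their angles.
open Classical in
theorem IsStarTriangle.massSq_some [Fintype V] (h : IsStarTriangle Gs Gt x) (k : ℝ) (i : Fin 3) :
    Gt.massSq k (x i) + (ellipticA k (Gs.angle k none (some (x i))) -
        jacobiSc k (Gs.angle k none (some (x i)))) =
      Gs.massSq k (some (x i)) + ∑ j ∈ Finset.univ.erase i,
        (ellipticA k (Gt.angle k (x i) (x j)) - jacobiSc k (Gt.angle k (x i) (x j))) := by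
  have hnone : Gs.graph.Adj (some (x i)) none := ((h.star_adj _).2 ⟨i, rfl⟩).symm
  have hsplit : ∀ v, v ∈ Finset.univ.filter (fun y => Gt.graph.Adj (x i) y) ↔
      v ∈ Finset.univ.filter (fun y => Gs.graph.Adj (some (x i)) (some y)) ∪
        (Finset.univ.erase i).image x := by
    intro v
    simp only [Finset.mem_filter, Finset.mem_univ, true_and, Finset.mem_union, h.other_adj,
      Finset.mem_image, Finset.mem_erase, and_true]
    constructor
    · intro hv
      by_cases hvx : ∃ j, v = x j
      · obtain ⟨j, rfl⟩ := hvx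
        exact Or.inr ⟨j, fun hj => Gt.graph.irrefl (hj ▸ hv), rfl⟩
      · exact Or.inl ⟨hv, fun hh => hvx hh.2⟩
    · rintro (hv | ⟨j, hj, rfl⟩)
      · exact hv.1
      · exact h.triangle_adj _ _ (Ne.symm hj)
  have hdisj : Disjoint (Finset.univ.filter (fun y => Gs.graph.Adj (some (x i)) (some y)))
      ((Finset.univ.erase i).image x) := by
    rw [Finset.disjoint_left]
    intro v hv hv'
    obtain ⟨j, -, rfl⟩ := Finset.mem_image.1 hv'
    exact ((h.other_adj _ _).1 (Finset.mem_filter.1 hv).2).2 ⟨⟨i, rfl⟩, ⟨j, rfl⟩⟩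
  rw [IsoradialGraph.massSq, Finset.ext hsplit, Finset.sum_union hdisj,
    Finset.sum_image h.injective.injOn, IsoradialGraph.massSq,
    Finset.sum_filter (s := (Finset.univ : Finset (Option V))),
    Fintype.sum_option, if_pos hnone, Finset.sum_filter, Gs.angle_comm k (some (x i)) none]
  simp only [h.angle_some]
  ring

end StarTriangle

/-! ### Labelled forests in the two rooted graphs -/

theorem restrictedZ_eq_networkSum {U β κ : Type*} [Fintype U] [DecidableEq κ] [DecidableEq β]
    [Fintype β] [Nonempty β] {H : SimpleGraph U} {w : Sym2 U → ℝ} {D : Set (Sym2 U)}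
    {S : Finset (Sym2 U)} (hD : D ⊆ H.edgeSet) (hS : (S : Set (Sym2 U)) ⊆ D)
    (b : β → U) (es : List (β × β × ℝ))
    (hE : ∀ e, e ∈ es.map (fun e => s(b e.1, b e.2.1)) ↔ e ∈ H.edgeSet ∧ e ∉ D)
    (hes : ∀ e ∈ es, w s(b e.1, b e.2.1) = e.2.2)
    (hnd : (es.map fun e => s(b e.1, b e.2.1)).Nodup)
    {L : U → κ} (hL : IsForestLabelling S L) (hb : ∀ u, ∃ i, L u = L (b i)) :
    restrictedZ H w D S = networkSum es (L ∘ b) := by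
  classical
  have hmem : ∀ e ∈ es, s(b e.1, b e.2.1) ∈ H.edgeSet ∧ s(b e.1, b e.2.1) ∉ D := fun e he =>
    (hE _).1 (List.mem_map_of_mem (f := fun e => s(b e.1, b e.2.1)) he)
  rw [restrictedZ_eq_treeSum w hD hS (E := (es.map fun e => s(b e.1, b e.2.1)).toFinset)
    (by ext e; simpa using hE e)]
  have := treeSum_eq_networkSum w b es (fun e he => ⟨(H.mem_edgeSet.1 (hmem e he).1).ne, hes e he⟩)
    hnd S L hL hb fun e he h => (hmem e he).2 (hS h)
  rw [← this]

/-- The forest `S` is transported to a graph with one more vertex `z`, the centre of the star, which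
forms a component of its own labelled `none`. -/
theorem IsForestLabelling.image {U U' κ : Type*} [DecidableEq (Sym2 U')] {S : Finset (Sym2 U)}
    {L : U → κ} (hL : IsForestLabelling S L) {φ : U → U'} (hφ : Function.Injective φ) {z : U'}
    (hz : ∀ a, a = z ∨ ∃ u, a = φ u) {L' : U' → Option κ} (hLz : L' z = none)
    (hLφ : ∀ u, L' (φ u) = some (L u))
    (hacyc : (SimpleGraph.fromEdgeSet
      ((S.image (Sym2.map φ) : Finset (Sym2 U')) : Set (Sym2 U'))).IsAcyclic) :
    IsForestLabelling (S.image (Sym2.map φ)) L' := by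
  refine ⟨hacyc, fun a b => ⟨eq_of_reachable fun a b hab => ?_, fun hab => ?_⟩⟩
  · obtain ⟨hab, hne⟩ := (SimpleGraph.fromEdgeSet_adj _).1 hab
    obtain ⟨e, he, heq⟩ := Finset.mem_image.1 (Finset.mem_coe.1 hab)
    induction e with | _ u v
    have huv : L u = L v := by
      by_cases h : u = v
      · rw [h]
      · exact (hL.reachable_iff u v).1
          (SimpleGraph.Adj.reachable ((SimpleGraph.fromEdgeSet_adj _).2 ⟨he, h⟩))
    rw [Sym2.map_mk, Sym2.eq_iff] at heq
    rcases heq with ⟨rfl, rfl⟩ | ⟨rfl, rfl⟩ <;> simp [hLφ, huv]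
  · have hom : ∀ u v, (SimpleGraph.fromEdgeSet (S : Set (Sym2 U))).Reachable u v →
        (SimpleGraph.fromEdgeSet
          ((S.image (Sym2.map φ) : Finset (Sym2 U')) : Set (Sym2 U'))).Reachable (φ u) (φ v) := by
      intro u v huv
      refine huv.map ⟨φ, fun {u v} h => ?_⟩
      obtain ⟨h, hne⟩ := (SimpleGraph.fromEdgeSet_adj _).1 h
      refine (SimpleGraph.fromEdgeSet_adj _).2 ⟨?_, hφ.ne hne⟩
      exact Finset.mem_coe.2 (Finset.mem_image.2 ⟨_, h, rfl⟩)
    rcases hz a with rfl | ⟨u, rfl⟩ <;> rcases hz b with rfl | ⟨v, rfl⟩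
    · exact SimpleGraph.Reachable.rfl
    · simp [hLz, hLφ] at hab
    · simp [hLz, hLφ] at hab
    · rw [hLφ, hLφ, Option.some_inj] at hab
      exact hom u v ((hL.reachable_iff u v).2 hab)

/-! ## Reduction of the restricted partition functions to small networks -/

section Reduction

variable {V : Type*}

/-- The ends of the edges which a star-triangle transformation modifies in the triangle graph. -/
def triangleVertex (x : Fin 3 → V) : Fin 4 → Rooted V :=
  ![Sum.inl (x 0), Sum.inl (x 1), Sum.inl (x 2), root V]

/-- The ends of the edges which a star-triangle transformation modifies in the star graph. -/
def starVertex (x : Fin 3 → V) : Fin 5 → Rooted (Option V) :=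
  ![Sum.inl (some (x 0)), Sum.inl (some (x 1)), Sum.inl (some (x 2)), root (Option V),
    Sum.inl none]

/-- The labelling of the rooted star graph induced by a labelling of the rooted triangle graph,
the centre of the star having a label of its own. -/
def starLabel {κ : Type*} (L : Rooted V → κ) : Rooted (Option V) → Option κ
  | Sum.inl none => none
  | Sum.inl (some v) => some (L (Sum.inl v))
  | Sum.inr u => some (L (Sum.inr u))

theorem commonVertex_injective : Function.Injective (commonVertex (V := V)) :=
  Sum.map_injective.2 ⟨Option.some_injective V, Function.injective_id⟩

theorem starLabel_commonVertex {κ : Type*} (L : Rooted V → κ) (u : Rooted V) :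
    starLabel L (commonVertex u) = some (L u) := by
  rcases u with u | u <;> rfl

theorem eq_centre_or_eq_commonVertex (a : Rooted (Option V)) :
    a = Sum.inl none ∨ ∃ u : Rooted V, a = commonVertex u := by
  rcases a with (_ | v) | u
  · exact Or.inl rfl
  · exact Or.inr ⟨Sum.inl v, rfl⟩
  · exact Or.inr ⟨Sum.inr u, rfl⟩

variable {Gs : IsoradialGraph (Option V)} {Gt : IsoradialGraph V} {x : Fin 3 → V}

theorem outerGraph_edgeSet_subset (h : IsStarTriangle Gs Gt x) :
    (outerGraph Gs.graph x).edgeSet ⊆ (rootedGraph Gt.graph).edgeSet := by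
  rw [outerGraph_eq h, SimpleGraph.edgeSet_deleteEdges]
  exact Set.sdiff_subset

theorem image_outerGraph_edgeSet_subset (Gs : SimpleGraph (Option V)) (x : Fin 3 → V) :
    Sym2.map commonVertex '' (outerGraph Gs x).edgeSet ⊆ (rootedGraph Gs).edgeSet := by
  rintro _ ⟨e, he, rfl⟩
  rw [outerGraph, SimpleGraph.edgeSet_deleteEdges] at he
  induction e with | _ u v
  exact he.1

theorem mem_triangle_edges (h : IsStarTriangle Gs Gt x) (e : Sym2 (Rooted V)) :
    e ∈ [s(triangleVertex x 0, triangleVertex x 3), s(triangleVertex x 1, triangleVertex x 3),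
        s(triangleVertex x 2, triangleVertex x 3), s(triangleVertex x 0, triangleVertex x 1),
        s(triangleVertex x 1, triangleVertex x 2), s(triangleVertex x 0, triangleVertex x 2)] ↔
      e ∈ (rootedGraph Gt.graph).edgeSet ∧ e ∉ (outerGraph Gs.graph x).edgeSet := by
  rw [outerGraph_eq h, SimpleGraph.edgeSet_deleteEdges]
  have h01 := h.triangle_adj 0 1 (by decide)
  have h12 := h.triangle_adj 1 2 (by decide)
  have h02 := h.triangle_adj 0 2 (by decide)
  constructor
  · intro he
    simp only [List.mem_cons, List.not_mem_nil, or_false] at he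
    have hroot : ∀ i, s(Sum.inl (x i), root V) ∈ (rootedGraph Gt.graph).edgeSet := fun i => trivial
    rcases he with rfl | rfl | rfl | rfl | rfl | rfl
    · exact ⟨hroot 0, fun hh => hh.2 (Or.inl ⟨0, rfl⟩)⟩
    · exact ⟨hroot 1, fun hh => hh.2 (Or.inl ⟨1, rfl⟩)⟩
    · exact ⟨hroot 2, fun hh => hh.2 (Or.inl ⟨2, rfl⟩)⟩
    · exact ⟨h01, fun hh => hh.2 (Or.inr ⟨0, 1, rfl⟩)⟩
    · exact ⟨h12, fun hh => hh.2 (Or.inr ⟨1, 2, rfl⟩)⟩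
    · exact ⟨h02, fun hh => hh.2 (Or.inr ⟨0, 2, rfl⟩)⟩
  · rintro ⟨he, he'⟩
    have he'' : e ∈ ({e | ∃ i, e = s(Sum.inl (x i), root V)} ∪
        {e | ∃ i j, e = s(Sum.inl (x i), Sum.inl (x j))} : Set (Sym2 (Rooted V))) := by
      by_contra hh
      exact he' ⟨he, hh⟩
    simp only [List.mem_cons, List.not_mem_nil, or_false]
    rcases he'' with ⟨i, rfl⟩ | ⟨i, j, rfl⟩
    · fin_cases i <;> simp [triangleVertex]
    · have hij : i ≠ j := fun hij => Gt.graph.irrefl (v := x i) (by subst hij; exact he)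
      fin_cases i <;> fin_cases j <;> simp [triangleVertex] at hij ⊢

theorem mem_star_edges (h : IsStarTriangle Gs Gt x) (e : Sym2 (Rooted (Option V))) :
    e ∈ [s(starVertex x 0, starVertex x 3), s(starVertex x 1, starVertex x 3),
        s(starVertex x 2, starVertex x 3), s(starVertex x 4, starVertex x 0),
        s(starVertex x 4, starVertex x 1), s(starVertex x 4, starVertex x 2),
        s(starVertex x 4, starVertex x 3)] ↔
      e ∈ (rootedGraph Gs.graph).edgeSet ∧
        e ∉ Sym2.map commonVertex '' (outerGraph Gs.graph x).edgeSet := by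
  have hcentre : ∀ a, s(Sum.inl none, a) ∉
      Sym2.map commonVertex '' (outerGraph Gs.graph x).edgeSet := by
    rintro a ⟨e, -, he⟩
    induction e with | _ u v
    rw [Sym2.map_mk, Sym2.eq_iff] at he
    rcases he with ⟨he, -⟩ | ⟨-, he⟩
    · rcases u with u | u <;> simp [commonVertex] at he
    · rcases v with v | v <;> simp [commonVertex] at he
  have himage : ∀ u v : Rooted V, s(commonVertex u, commonVertex v) ∈
      Sym2.map commonVertex '' (outerGraph Gs.graph x).edgeSet ↔
        s(u, v) ∈ (outerGraph Gs.graph x).edgeSet := by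
    intro u v
    rw [← Sym2.map_mk, (Sym2.map.injective commonVertex_injective).mem_set_image]
  have hroot : ∀ i, s(Sum.inl (some (x i)), root (Option V)) ∉
      Sym2.map commonVertex '' (outerGraph Gs.graph x).edgeSet := by
    intro i hh
    have := (himage (Sum.inl (x i)) (root V)).1 hh
    rw [outerGraph, SimpleGraph.edgeSet_deleteEdges] at this
    exact this.2 ⟨i, rfl⟩
  have hstar : ∀ i, s(Sum.inl none, Sum.inl (some (x i))) ∈ (rootedGraph Gs.graph).edgeSet :=
    fun i => (h.star_adj (x i)).2 ⟨i, rfl⟩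
  constructor
  · intro he
    simp only [List.mem_cons, List.not_mem_nil, or_false] at he
    rcases he with rfl | rfl | rfl | rfl | rfl | rfl | rfl
    · exact ⟨trivial, hroot 0⟩
    · exact ⟨trivial, hroot 1⟩
    · exact ⟨trivial, hroot 2⟩
    · exact ⟨hstar 0, hcentre _⟩
    · exact ⟨hstar 1, hcentre _⟩
    · exact ⟨hstar 2, hcentre _⟩
    · exact ⟨trivial, hcentre _⟩
  · rintro ⟨he, he'⟩
    have hlist : ∀ a, (rootedGraph Gs.graph).Adj (Sum.inl none) a →
        s(Sum.inl none, a) ∈ [s(starVertex x 0, starVertex x 3),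
          s(starVertex x 1, starVertex x 3),
          s(starVertex x 2, starVertex x 3), s(starVertex x 4, starVertex x 0),
          s(starVertex x 4, starVertex x 1), s(starVertex x 4, starVertex x 2),
          s(starVertex x 4, starVertex x 3)] := by
      rintro ((_ | v) | u) ha
      · exact absurd ha (Gs.graph.irrefl)
      · obtain ⟨i, rfl⟩ := (h.star_adj v).1 ha
        fin_cases i <;> simp [starVertex]
      · simp [starVertex, root]
    induction e with | _ a b
    rcases eq_centre_or_eq_commonVertex a with rfl | ⟨u, rfl⟩
    · exact hlist b he
    rcases eq_centre_or_eq_commonVertex b with rfl | ⟨v, rfl⟩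
    · rw [Sym2.eq_swap (a := commonVertex u)]
      exact hlist _ he.symm
    rw [himage, outerGraph, SimpleGraph.edgeSet_deleteEdges] at he'
    have : s(u, v) ∈ {e | ∃ i, e = s(Sum.inl (x i), root V)} := by
      by_contra hh
      exact he' ⟨he, hh⟩
    obtain ⟨i, hi⟩ := this
    rw [← Sym2.map_mk commonVertex u v, hi]
    fin_cases i <;> simp [starVertex, commonVertex, root]

theorem triangle_edges_nodup (hinj : Function.Injective x) :
    [s(triangleVertex x 0, triangleVertex x 3), s(triangleVertex x 1, triangleVertex x 3),
      s(triangleVertex x 2, triangleVertex x 3), s(triangleVertex x 0, triangleVertex x 1),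
      s(triangleVertex x 1, triangleVertex x 2),
      s(triangleVertex x 0, triangleVertex x 2)].Nodup := by
  simp [triangleVertex, root, hinj.eq_iff]

theorem star_edges_nodup (hinj : Function.Injective x) :
    [s(starVertex x 0, starVertex x 3), s(starVertex x 1, starVertex x 3),
      s(starVertex x 2, starVertex x 3), s(starVertex x 4, starVertex x 0),
      s(starVertex x 4, starVertex x 1), s(starVertex x 4, starVertex x 2),
      s(starVertex x 4, starVertex x 3)].Nodup := by
  simp [starVertex, root, hinj.eq_iff]

/-- In the forest formed by the outer edges of a spanning tree of the rooted triangle graph, each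
component has a vertex in common with the edges of the triangle network. -/
theorem exists_label_eq_triangleVertex (h : IsStarTriangle Gs Gt x)
    {S T : Finset (Sym2 (Rooted V))}
    (hT : IsTreeExtension (rootedGraph Gt.graph) (outerGraph Gs.graph x).edgeSet S T)
    {κ : Type*} {L : Rooted V → κ} (hL : IsForestLabelling S L) (u : Rooted V) :
    ∃ i, L u = L (triangleVertex x i) := by
  obtain ⟨⟨hTH, htree⟩, hTS⟩ := hT
  -- The property is constant along the edges of `T`: an outer edge lies in `S` and preserves the
  -- label, any other edge has both ends among the `triangleVertex x i`. Connectedness of `T` then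
  -- carries it from the root.
  have hconst : ∀ a b, (SimpleGraph.fromEdgeSet (T : Set (Sym2 (Rooted V)))).Adj a b →
      (∃ i, L a = L (triangleVertex x i)) = ∃ i, L b = L (triangleVertex x i) := by
    intro a b hab
    obtain ⟨hab, hne⟩ := (SimpleGraph.fromEdgeSet_adj _).1 hab
    by_cases hout : s(a, b) ∈ (outerGraph Gs.graph x).edgeSet
    · have hS : s(a, b) ∈ (S : Set (Sym2 (Rooted V))) := hTS ▸ ⟨hab, hout⟩
      rw [(hL.reachable_iff a b).1
        (SimpleGraph.Adj.reachable ((SimpleGraph.fromEdgeSet_adj _).2 ⟨hS, hne⟩))]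
    · have := (mem_triangle_edges h _).2 ⟨hTH hab, hout⟩
      simp only [List.mem_cons, List.not_mem_nil, or_false, Sym2.eq_iff] at this
      have ha : ∃ i, L a = L (triangleVertex x i) := by grind (splits := 20)
      have hb : ∃ i, L b = L (triangleVertex x i) := by grind (splits := 20)
      exact propext ⟨fun _ => hb, fun _ => ha⟩
  have := eq_of_reachable (L := fun u => ∃ i, L u = L (triangleVertex x i)) hconst
    (htree.connected.preconnected u (root V))
  rw [this]
  exact ⟨3, rfl⟩

/-- Sufficient conditions for Z-invariance under a star-triangle transformation. -/
theorem IsStarTriangle.isZInvariantWith [Fintype V] (h : IsStarTriangle Gs Gt x)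
    {ρs : Sym2 (Option V) → ℝ} {ms : Option V → ℝ} {ρt : Sym2 V → ℝ} {mt : V → ℝ} {C : ℝ}
    {s : Fin 3 → ℝ} (hs : ∀ i, ρs s(none, some (x i)) = s i) (hC : C ≠ 0)
    (hsum : s 0 + s 1 + s 2 + ms none = C)
    (hm : ∀ i, mt (x i) = ms (some (x i)) + s i * ms none / C)
    (h01 : ρt s(x 0, x 1) = s 0 * s 1 / C) (h12 : ρt s(x 1, x 2) = s 1 * s 2 / C)
    (h02 : ρt s(x 0, x 2) = s 0 * s 2 / C) :
    IsZInvariantWith Gs.graph Gt.graph x ρs ms ρt mt C := by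
  classical
  rintro S hS ⟨Ts, ⟨-, hTs⟩, hTsS⟩ ⟨Tt, hTt⟩
  set G := SimpleGraph.fromEdgeSet (S : Set (Sym2 (Rooted V))) with hG
  have hSTt : (S : Set (Sym2 (Rooted V))) ⊆ Tt := hTt.2 ▸ Set.inter_subset_left
  have hL : IsForestLabelling S G.connectedComponentMk :=
    ⟨hTt.1.2.isAcyclic.anti (SimpleGraph.fromEdgeSet_mono hSTt),
      fun u v => SimpleGraph.ConnectedComponent.eq.symm⟩
  have htouch := exists_label_eq_triangleVertex h hTt hL
  have hLs := hL.image commonVertex_injective (z := Sum.inl none) eq_centre_or_eq_commonVertex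
    (L' := starLabel G.connectedComponentMk) rfl (starLabel_commonVertex _)
    (hTs.isAcyclic.anti (SimpleGraph.fromEdgeSet_mono (hTsS ▸ Set.inter_subset_left)))
  rw [restrictedZ_eq_networkSum (outerGraph_edgeSet_subset h) hS (triangleVertex x)
    [(0, 3, ms (some (x 0)) + s 0 * ms none / C), (1, 3, ms (some (x 1)) + s 1 * ms none / C),
      (2, 3, ms (some (x 2)) + s 2 * ms none / C), (0, 1, s 0 * s 1 / C), (1, 2, s 1 * s 2 / C),
      (0, 2, s 0 * s 2 / C)] (mem_triangle_edges h)
    (by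
      simp only [List.forall_mem_cons, ← hm, ← h01, ← h12, ← h02]
      exact ⟨rfl, rfl, rfl, rfl, rfl, rfl, by simp⟩)
    (triangle_edges_nodup h.injective) hL htouch,
    restrictedZ_eq_networkSum (image_outerGraph_edgeSet_subset _ _)
    (by rw [Finset.coe_image]; exact Set.image_mono hS) (starVertex x)
    [(0, 3, ms (some (x 0))), (1, 3, ms (some (x 1))), (2, 3, ms (some (x 2))),
      (4, 0, s 0), (4, 1, s 1), (4, 2, s 2), (4, 3, ms none)] (mem_star_edges h)
    (by
      simp only [List.forall_mem_cons, ← hs]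
      exact ⟨rfl, rfl, rfl, rfl, rfl, rfl, rfl, by simp⟩)
    (star_edges_nodup h.injective) hLs ?_]
  · have := networkSum_star (G.connectedComponentMk (Sum.inl (x 0)))
      (G.connectedComponentMk (Sum.inl (x 1))) (G.connectedComponentMk (Sum.inl (x 2)))
      (G.connectedComponentMk (root V)) (ms (some (x 0))) (ms (some (x 1))) (ms (some (x 2)))
      (s 0) (s 1) (s 2) (ms none) hC hsum
    convert! this using 2
    · ext i : 1
      fin_cases i <;> rfl
    · congr 1
      ext i : 1
      fin_cases i <;> rfl
  · intro a
    rcases eq_centre_or_eq_commonVertex a with rfl | ⟨u, rfl⟩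
    · exact ⟨4, rfl⟩
    · obtain ⟨i, hi⟩ := htouch u
      -- The first four star vertices are the images of the triangle vertices, in the same order.
      refine ⟨i.castSucc, ?_⟩
      rw [starLabel_commonVertex, hi, ← starLabel_commonVertex]
      congr 1
      fin_cases i <;> rfl

end Reduction

end

/-! ### Z-invariance of the elliptic weights -/

theorem theorem5p6 {V : Type*} [Fintype V] (k : ℝ) (hk : k ∈ Set.Ico (0 : ℝ) 1)
    (Gs : IsoradialGraph (Option V)) (Gt : IsoradialGraph V) (x : Fin 3 → V)
    (hst : IsStarTriangle Gs Gt x) :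
    IsZInvariantWith Gs.graph Gt.graph x
      (Gs.conductance k) (Gs.massSq k) (Gt.conductance k) (Gt.massSq k)
      (complModulus k * (jacobiSc k (Gs.angle k none (some (x 0))) *
        jacobiSc k (Gs.angle k none (some (x 1))) *
        jacobiSc k (Gs.angle k none (some (x 2))))) := by
  obtain ⟨θ, hθ, hsum, hs, h01, h12, h02⟩ := hst.angles hk
  have hk' := complModulus_pos hk
  have hpos := fun i => jacobiSc_pos hk (hθ i)
  have p0 := hpos 0
  have p1 := hpos 1
  have p2 := hpos 2
  -- In `m² + ∑ sc θ_i` the `sc` terms cancel, so the total weight of the star is `∑ A(θ_i)`, which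
  -- is the announced constant.
  have hA := ellipticA_add_add hk (hθ 0) (hθ 1) (hθ 2) hsum
  have hm0 : Gs.massSq k none = complModulus k * (jacobiSc k (θ 0) * jacobiSc k (θ 1) *
      jacobiSc k (θ 2)) - jacobiSc k (θ 0) - jacobiSc k (θ 1) - jacobiSc k (θ 2) := by
    rw [hst.massSq_none, Fin.sum_univ_three, hs, hs, hs]
    linarith
  have e0 : (Finset.univ.erase 0 : Finset (Fin 3)) = {1, 2} := by decide
  have e1 : (Finset.univ.erase 1 : Finset (Fin 3)) = {0, 2} := by decide
  have e2 : (Finset.univ.erase 2 : Finset (Fin 3)) = {0, 1} := by decide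
  rw [hs, hs, hs]
  refine hst.isZInvariantWith (s := fun i => jacobiSc k (θ i)) (fun i => ?_) (by positivity) ?_ ?_
    ?_ ?_ ?_
  · rw [← hs]; rfl
  · rw [hm0]; ring
  · rw [Fin.forall_fin_succ, Fin.forall_fin_two, hm0]
    refine ⟨?_, ?_, ?_⟩
    -- By `ellipticA_star` the terms `A(K - θ_j)` cancel from the mass balance; the rest is the
    -- expansion of `s_i (C - s_0 - s_1 - s_2) / C`.
    · have h := hst.massSq_some k 0
      rw [e0, Finset.sum_pair (by decide), hs, h01, h02, jacobiSc_ellipticK_sub hk,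
        jacobiSc_ellipticK_sub hk, ellipticA_star hk (hθ 0) (hθ 1) (hθ 2) hsum] at h
      field_simp at h ⊢
      linarith
    · have h := hst.massSq_some k 1
      rw [e1, Finset.sum_pair (by decide), hs, Gt.angle_comm k (x 1) (x 0), h01, h12,
        jacobiSc_ellipticK_sub hk, jacobiSc_ellipticK_sub hk,
        ellipticA_star hk (hθ 1) (hθ 0) (hθ 2) (by linarith)] at h
      simp only [Fin.succ_zero_eq_one]
      field_simp at h ⊢
      linarith
    · have h := hst.massSq_some k 2
      rw [e2, Finset.sum_pair (by decide), hs, Gt.angle_comm k (x 2) (x 0),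
        Gt.angle_comm k (x 2) (x 1), h02, h12,
        jacobiSc_ellipticK_sub hk, jacobiSc_ellipticK_sub hk,
        ellipticA_star hk (hθ 2) (hθ 0) (hθ 1) (by linarith)] at h
      simp only [Fin.succ_one_eq_two]
      field_simp at h ⊢
      linarith
  · change jacobiSc k (Gt.angle k (x 0) (x 1)) = _
    rw [h01, jacobiSc_ellipticK_sub hk]
    field_simp
  · change jacobiSc k (Gt.angle k (x 1) (x 2)) = _
    rw [h12, jacobiSc_ellipticK_sub hk]
    field_simp
  · change jacobiSc k (Gt.angle k (x 0) (x 2)) = _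
    rw [h02, jacobiSc_ellipticK_sub hk]
    field_simp
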